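/- There are a randomized algorithm and absolute constants $c,\delta>0$ such that the following holds for every $n$-vertex graph $G$ and every non-negative integer $s$, with $\sigma=s/n$ if $s\le n$ and $\sigma=1$ if $s>n$. Given $G$ and $s$, the algorithm always halts (whatever its random bits are) within time $O^*\big(2^{(1-c\sigma^4)n}\big)$, where $O^*$ suppresses factors polynomial in the size of the input $(G,s)$ (and these factors, like $c$ and $\delta$, do not depend on $G$, $s$, $\sigma$). It outputs NO (with certainty) if the chromatic number satisfies $\chi(G)>s$, and it outputs YES with probability at least $\delta$ if $\chi(G)<s$. Here an algorithm is a program for a random access machine on natural numbers with a fair-coin instruction, and time is logarithmic cost (every operation is charged polynomially in the bit lengths of the numbers involved). -/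

import Mathlib

/-!
A randomized random access machine with logarithmic cost, and its use on graphs.

The machine has registers and arrays (indexed memories), all cells holding natural numbers.
A program is a finite text, so it names finitely many registers and arrays. Every elementary
operation is charged at least the bit lengths of the numbers it touches (multiplication,
division, and for uniformity every binary operation, is charged the product of the lengths).
-/

namespace RandRAM

/-- Binary arithmetic, comparison and bitwise operations on natural numbers. -/
inductive BinOp
  | add | sub | mul | div | mod | lt | eq | land | lor

/-- The value of a binary operation: subtraction is truncated, `x / 0 = 0`, `x % 0 = x`,
comparisons return `0` or `1`. -/
def BinOp.eval : BinOp → ℕ → ℕ → ℕ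
  | .add, x, y => x + y
  | .sub, x, y => x - y
  | .mul, x, y => x * y
  | .div, x, y => x / y
  | .mod, x, y => x % y
  | .lt, x, y => if x < y then 1 else 0
  | .eq, x, y => if x = y then 1 else 0
  | .land, x, y => x &&& y
  | .lor, x, y => x ||| y

/-- Expressions: constants, contents of registers, contents of array cells, binary operations. -/
inductive Expr
  | const (k : ℕ)
  | reg (r : ℕ)
  | get (a : ℕ) (i : Expr)
  | bin (o : BinOp) (e₁ e₂ : Expr)

/-- Programs. `flip r` puts a fresh fair random bit into register `r`. -/
inductive Prog
  | skip
  | assign (r : ℕ) (e : Expr)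
  | put (a : ℕ) (i e : Expr)
  | flip (r : ℕ)
  | seq (p q : Prog)
  | cond (e : Expr) (p q : Prog)
  | loop (e : Expr) (p : Prog)

/-- A state of the machine: registers, arrays, and the number of random bits used so far. -/
@[ext]
structure State where
  reg : ℕ → ℕ
  arr : ℕ → ℕ → ℕ
  used : ℕ

/-- The value of an expression. -/
def Expr.eval (σ : State) : Expr → ℕ
  | .const k => k
  | .reg r => σ.reg r
  | .get a i => σ.arr a (i.eval σ)
  | .bin o e₁ e₂ => o.eval (e₁.eval σ) (e₂.eval σ)

/-- The cost of evaluating an expression; `Nat.size` is the bit length. -/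
def Expr.cost (σ : State) : Expr → ℕ
  | .const k => 1 + Nat.size k
  | .reg r => 1 + Nat.size (σ.reg r)
  | .get a i => i.cost σ + 1 + Nat.size (i.eval σ) + Nat.size (σ.arr a (i.eval σ))
  | .bin _ e₁ e₂ => e₁.cost σ + e₂.cost σ +
      (1 + Nat.size (e₁.eval σ)) * (1 + Nat.size (e₂.eval σ))

/-- Write `v` into register `r`. -/
def State.setReg (σ : State) (r v : ℕ) : State :=
  { σ with reg := Function.update σ.reg r v }

/-- Write `v` into cell `i` of array `a`. -/
def State.setArr (σ : State) (a i v : ℕ) : State :=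
  { σ with arr := Function.update σ.arr a (Function.update (σ.arr a) i v) }

/-- Put the next bit of the random tape `ω` into register `r`. -/
def State.flip (ω : ℕ → Bool) (σ : State) (r : ℕ) : State :=
  { σ with reg := Function.update σ.reg r (ω σ.used).toNat, used := σ.used + 1 }

/-- `Exec ω p σ τ t`: on the random tape `ω`, the program `p` started in state `σ` halts in
state `τ`, at total cost `t`. A test succeeds iff its value is nonzero. -/
inductive Exec (ω : ℕ → Bool) : Prog → State → State → ℕ → Prop
  | skip (σ : State) : Exec ω .skip σ σ 1
  | assign (σ : State) (r : ℕ) (e : Expr) :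
      Exec ω (.assign r e) σ (σ.setReg r (e.eval σ)) (e.cost σ + 1 + Nat.size (e.eval σ))
  | put (σ : State) (a : ℕ) (i e : Expr) :
      Exec ω (.put a i e) σ (σ.setArr a (i.eval σ) (e.eval σ))
        (i.cost σ + e.cost σ + 1 + Nat.size (i.eval σ) + Nat.size (e.eval σ))
  | flip (σ : State) (r : ℕ) : Exec ω (.flip r) σ (σ.flip ω r) 1
  | seq {p q : Prog} {σ τ υ : State} {t u : ℕ} :
      Exec ω p σ τ t → Exec ω q τ υ u → Exec ω (.seq p q) σ υ (t + u)
  | cond_true {e : Expr} {p q : Prog} {σ τ : State} {t : ℕ} :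
      e.eval σ ≠ 0 → Exec ω p σ τ t → Exec ω (.cond e p q) σ τ (e.cost σ + 1 + t)
  | cond_false {e : Expr} {p q : Prog} {σ τ : State} {t : ℕ} :
      e.eval σ = 0 → Exec ω q σ τ t → Exec ω (.cond e p q) σ τ (e.cost σ + 1 + t)
  | loop_true {e : Expr} {p : Prog} {σ τ υ : State} {t u : ℕ} :
      e.eval σ ≠ 0 → Exec ω p σ τ t → Exec ω (.loop e p) τ υ u →
        Exec ω (.loop e p) σ υ (e.cost σ + 1 + t + u)
  | loop_false {e : Expr} {p : Prog} {σ : State} :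
      e.eval σ = 0 → Exec ω (.loop e p) σ σ (e.cost σ + 1)

/-- For a fixed random tape the machine is deterministic, final state and cost included. -/
theorem Exec.det {ω : ℕ → Bool} {p : Prog} {σ τ τ' : State} {t t' : ℕ}
    (h : Exec ω p σ τ t) (h' : Exec ω p σ τ' t') : τ = τ' ∧ t = t' := by
  induction h generalizing τ' t' with
  | skip | assign | put | flip => cases h'; exact ⟨rfl, rfl⟩
  | seq _ _ ih₁ ih₂ =>
    cases h' with
    | seq a b =>
      obtain ⟨rfl, rfl⟩ := ih₁ a
      obtain ⟨rfl, rfl⟩ := ih₂ b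
      exact ⟨rfl, rfl⟩
  | cond_true he _ ih =>
    cases h' with
    | cond_true _ a => obtain ⟨rfl, rfl⟩ := ih a; exact ⟨rfl, rfl⟩
    | cond_false he' _ => exact absurd he' he
  | cond_false he _ ih =>
    cases h' with
    | cond_true he' _ => exact absurd he he'
    | cond_false _ a => obtain ⟨rfl, rfl⟩ := ih a; exact ⟨rfl, rfl⟩
  | loop_true he _ _ ih₁ ih₂ =>
    cases h' with
    | loop_true _ a b =>
      obtain ⟨rfl, rfl⟩ := ih₁ a
      obtain ⟨rfl, rfl⟩ := ih₂ b
      exact ⟨rfl, rfl⟩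
    | loop_false he' => exact absurd he' he
  | loop_false he =>
    cases h' with
    | loop_true he' _ _ => exact absurd he he'
    | loop_false _ => exact ⟨rfl, rfl⟩

/-- The law of an infinite sequence of independent fair random bits. -/
noncomputable def fairCoins : MeasureTheory.Measure (ℕ → Bool) :=
  MeasureTheory.Measure.infinitePi fun _ : ℕ => (PMF.uniformOfFintype Bool).toMeasure

open Classical in
/-- The initial state on input `(G, s)`, for a graph `G` with vertices `0, …, n - 1`:
register `0` holds `n`, register `1` holds `s`, array `0` holds the adjacency matrix of `G`
row by row (entry `(i, j)` in cell `n * i + j`), and everything else is `0`. -/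
noncomputable def initState (n : ℕ) (G : SimpleGraph (Fin n)) (s : ℕ) : State where
  reg r := if r = 0 then n else if r = 1 then s else 0
  arr a x := if a = 0 ∧ ∃ i j : Fin n, G.Adj i j ∧ x = n * i + j then 1 else 0
  used := 0

/-- The size in bits of the input `(G, s)`: the adjacency matrix and the numbers `n`, `s`. -/
def inputSize (n s : ℕ) : ℕ := n ^ 2 + Nat.size n + Nat.size s

/-- On input `(G, s)` and random tape `ω`, the program `P` halts at cost `t` with answer `b`:
the answer is YES (`true`) if register `0` is nonzero in the final state, and NO otherwise. -/
def Answers (P : Prog) {n : ℕ} (G : SimpleGraph (Fin n)) (s : ℕ) (ω : ℕ → Bool)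
    (b : Bool) (t : ℕ) : Prop :=
  ∃ τ : State, Exec ω P (initState n G s) τ t ∧ (b = true ↔ τ.reg 0 ≠ 0)

end RandRAM

/-!
If `s > n`, the answer is YES. Otherwise suppose that the graph has a proper colouring with `s - 1`
colours; recolouring single vertices, one may assume that all colours occur. Some `t = (s - 1) / 2`
of the colour classes have a union of at most `n / 2` vertices. Each of the `2 ^ t` unions of some of
these classes can be filled up to exactly `n / 2` vertices by adding the vertices of the other
classes in the order of their colours. Then at most one class is split, so that the set `S` obtained
and its complement can be coloured with `s` colours in total: this is where the slack of one colour
is spent (`exists_many_halves`). So a uniformly random set is such an `S` with probability at least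
`2 ^ (t - n)`, and among `N = 2 ^ (n - t)` independent samples there is one with probability at least
`1 - 1 / e` (`half_le_fairCoins`). Conversely, any `S` of this kind proves that `s` colours suffice
(`chromaticNumber_le`), so that a graph with larger chromatic number is never accepted.

The chromatic numbers of the sampled sets and of their complements are found by inclusion and
exclusion, restricted to the family of all subsets of these sets. On such a downward closed family
both the zeta transform (from the indicator of independence to the number `i(X)` of independent
subsets of `X`) and the Möbius transform (from `i(X) ^ k` to the number of covers of `X` by `k`
independent sets) take at most `n` additions or subtractions per member (`Runs.transform`,
`sum_powerset_covers`). All partial results are counts, so truncated subtraction is harmless.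

The time is thus polynomial in `n` times the sum of `N` and the size of the family, and only samples
with exactly `n / 2` elements are used. Let `σ = s / n > 0` and `ε = (σ / 16) ^ 2`. A member of the
family has at most `(1 / 2 - ε) n` elements, and there are at most `2 ^ n * exp (-2 ε ^ 2 n)` such
sets, or it is one of `2 N` sets with at most `ε n + 1` elements removed. There are at most
`(16 / σ) exp (σ n / 8)` ways to remove them, against `N ≤ 2 * 2 ^ n * exp (-σ n / 4)`
(`samples_add_card_family_le`).

On the side of the machine, all numbers that occur have polynomially many bits. Under such a bound
an elementary statement has a polynomial cost (`Expr.cost_le`), and `Runs` is a Hoare logic that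
counts elementary statements.
-/

namespace RandRAM

section

/-! ### Running programs within a budget -/

/-- The syntactic weight of an expression: it controls both the bit length of the value and the
cost of the evaluation, once a bound on the bit lengths of all cells is known. -/
def Expr.wt : Expr → ℕ
  | .const k => 1 + Nat.size k
  | .reg _ => 1
  | .get _ i => i.wt + 1
  | .bin _ e₁ e₂ => e₁.wt + e₂.wt

/-- All registers and all array cells hold numbers of at most `B` bits. -/
structure State.Bdd (B : ℕ) (σ : State) : Prop where
  reg : ∀ r, σ.reg r < 2 ^ B
  arr : ∀ a i, σ.arr a i < 2 ^ B

lemma Expr.one_le_wt (e : Expr) : 1 ≤ e.wt := by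
  induction e <;> simp only [Expr.wt] <;> omega

lemma BinOp.size_eval_le (o : BinOp) (x y : ℕ) :
    Nat.size (o.eval x y) ≤ max 1 (Nat.size x + Nat.size y) := by
  have hx := Nat.lt_size_self x
  have hy := Nat.lt_size_self y
  have key : ∀ z, z < 2 ^ Nat.size x * 2 ^ Nat.size y →
      Nat.size z ≤ max 1 (Nat.size x + Nat.size y) := fun z hz =>
    (Nat.size_le.2 (by rwa [pow_add])).trans (le_max_right _ _)
  have hx1 : 1 ≤ 2 ^ Nat.size x := Nat.one_le_two_pow
  have hy1 : 1 ≤ 2 ^ Nat.size y := Nat.one_le_two_pow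
  have hxx : ∀ z, z ≤ x → z < 2 ^ Nat.size x * 2 ^ Nat.size y := fun z hz => by nlinarith
  cases o with
  | add => exact key _ (by simp only [BinOp.eval]; nlinarith)
  | sub => exact key _ (hxx _ (Nat.sub_le _ _))
  | mul => exact key _ (by simp only [BinOp.eval]; exact Nat.mul_lt_mul'' hx hy)
  | div => exact key _ (hxx _ (Nat.div_le_self _ _))
  | mod => exact key _ (hxx _ (Nat.mod_le _ _))
  | lt => simp only [BinOp.eval]; split_ifs <;> simp
  | eq => simp only [BinOp.eval]; split_ifs <;> simp
  | land => exact key _ (hxx _ Nat.and_le_left)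
  | lor =>
    refine (Nat.size_le.2 (Nat.or_lt_two_pow (n := Nat.size x + Nat.size y) ?_ ?_)).trans
      (le_max_right _ _)
    · exact hx.trans_le (Nat.pow_le_pow_right (by norm_num) (by omega))
    · exact hy.trans_le (Nat.pow_le_pow_right (by norm_num) (by omega))

lemma Expr.size_eval_le {B : ℕ} {σ : State} (hσ : σ.Bdd B) (e : Expr) :
    Nat.size (e.eval σ) ≤ e.wt * (B + 1) := by
  induction e with
  | const k => simp only [Expr.eval, Expr.wt]; nlinarith [Nat.zero_le (Nat.size k), Nat.zero_le B]
  | reg r =>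
    have := Nat.size_le.2 (hσ.reg r)
    simp only [Expr.eval, Expr.wt]; omega
  | get a i _ =>
    have := Nat.size_le.2 (hσ.arr a (i.eval σ))
    simp only [Expr.eval, Expr.wt]; nlinarith [Nat.zero_le i.wt]
  | bin o e₁ e₂ h₁ h₂ =>
    have := BinOp.size_eval_le o (e₁.eval σ) (e₂.eval σ)
    have h3 := e₁.one_le_wt
    simp only [Expr.eval, Expr.wt]
    refine this.trans (max_le ?_ ?_)
    · nlinarith [Nat.zero_le (e₂.wt * (B + 1)), Nat.zero_le B]
    · nlinarith

lemma Expr.cost_le {B : ℕ} {σ : State} (hσ : σ.Bdd B) (e : Expr) :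
    e.cost σ ≤ e.wt ^ 2 * (B + 2) ^ 2 := by
  induction e with
  | const k =>
    simp only [Expr.cost, Expr.wt]
    have : 1 ≤ (1 + Nat.size k) * (B + 2) ^ 2 := Nat.succ_le_of_lt (by positivity)
    calc 1 + Nat.size k = (1 + Nat.size k) * 1 := by ring
      _ ≤ (1 + Nat.size k) * ((1 + Nat.size k) * (B + 2) ^ 2) := Nat.mul_le_mul_left _ this
      _ = _ := by ring
  | reg r =>
    have := Nat.size_le.2 (hσ.reg r)
    simp only [Expr.cost, Expr.wt]; nlinarith
  | get a i h =>
    have h1 := Nat.size_le.2 (hσ.arr a (i.eval σ))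
    have h2 := Expr.size_eval_le hσ i
    have h3 := i.one_le_wt
    simp only [Expr.cost, Expr.wt]
    nlinarith [Nat.zero_le (i.wt * B), Nat.zero_le (i.wt * B ^ 2)]
  | bin o e₁ e₂ h₁ h₂ =>
    have h3 := Expr.size_eval_le hσ e₁
    have h4 := Expr.size_eval_le hσ e₂
    have h5 : 1 + Nat.size (e₁.eval σ) ≤ e₁.wt * (B + 2) := by nlinarith [e₁.one_le_wt]
    have h6 : 1 + Nat.size (e₂.eval σ) ≤ e₂.wt * (B + 2) := by nlinarith [e₂.one_le_wt]
    have h7 := Nat.mul_le_mul h5 h6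
    simp only [Expr.cost, Expr.wt]
    nlinarith [Nat.zero_le (e₁.wt * (B + 2) * (e₂.wt * (B + 2)))]

/-- On the tape `ω`, the program `p` started in `σ` halts in a state satisfying `Q`, and its cost
is at most that of `k` elementary statements of weight `30` on numbers of `B` bits. -/
def Runs (ω : ℕ → Bool) (B : ℕ) (p : Prog) (σ : State) (k : ℕ) (Q : State → Prop) : Prop :=
  ∃ τ t, Exec ω p σ τ t ∧ t ≤ k * (1000 * (B + 2) ^ 2) ∧ Q τ

variable {ω : ℕ → Bool} {B : ℕ} {p q : Prog} {σ : State} {k l m : ℕ} {Q R : State → Prop}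

lemma Runs.mono (h : Runs ω B p σ k Q) (hk : k ≤ l) (hQ : ∀ τ, Q τ → R τ) :
    Runs ω B p σ l R := by
  obtain ⟨τ, t, h₁, h₂, h₃⟩ := h
  exact ⟨τ, t, h₁, h₂.trans (Nat.mul_le_mul_right _ hk), hQ _ h₃⟩

lemma Runs.skip (hk : 1 ≤ k) (hQ : Q σ) : Runs ω B .skip σ k Q :=
  ⟨σ, 1, .skip σ, by nlinarith [Nat.zero_le B, Nat.zero_le (B ^ 2)], hQ⟩

lemma Runs.assign {r : ℕ} {e : Expr} (hσ : σ.Bdd B) (hw : e.wt ≤ 30) (hk : 1 ≤ k)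
    (hQ : Q (σ.setReg r (e.eval σ))) : Runs ω B (.assign r e) σ k Q := by
  refine ⟨_, _, .assign σ r e, ?_, hQ⟩
  have h1 := e.cost_le hσ
  have h2 := e.size_eval_le hσ
  have h3 : e.wt ^ 2 * (B + 2) ^ 2 ≤ 30 ^ 2 * (B + 2) ^ 2 := by gcongr
  have h4 : e.wt * (B + 1) ≤ 30 * (B + 1) := by gcongr
  have h5 : 1 * (1000 * (B + 2) ^ 2) ≤ k * (1000 * (B + 2) ^ 2) := by gcongr
  nlinarith

lemma Runs.put {a : ℕ} {i e : Expr} (hσ : σ.Bdd B) (hw : i.wt + e.wt ≤ 30) (hk : 1 ≤ k)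
    (hQ : Q (σ.setArr a (i.eval σ) (e.eval σ))) : Runs ω B (.put a i e) σ k Q := by
  refine ⟨_, _, .put σ a i e, ?_, hQ⟩
  have h1 := e.cost_le hσ
  have h2 := e.size_eval_le hσ
  have h1' := i.cost_le hσ
  have h2' := i.size_eval_le hσ
  have h3 : (e.wt ^ 2 + i.wt ^ 2) * (B + 2) ^ 2 ≤ 30 ^ 2 * (B + 2) ^ 2 := by
    gcongr; nlinarith [Nat.zero_le (i.wt * e.wt)]
  have h4 : (i.wt + e.wt) * (B + 1) ≤ 30 * (B + 1) := by gcongr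
  have h5 : 1 * (1000 * (B + 2) ^ 2) ≤ k * (1000 * (B + 2) ^ 2) := by gcongr
  nlinarith

lemma Runs.flip {r : ℕ} (hk : 1 ≤ k) (hQ : Q (σ.flip ω r)) : Runs ω B (.flip r) σ k Q :=
  ⟨_, _, .flip σ r, by nlinarith [Nat.zero_le B, Nat.zero_le (B ^ 2)], hQ⟩

lemma Runs.seq (h₁ : Runs ω B p σ k R) (hk : k + l ≤ m)
    (h₂ : ∀ τ, R τ → Runs ω B q τ l Q) : Runs ω B (.seq p q) σ m Q := by
  obtain ⟨τ, t, h₁, h₂', h₃⟩ := h₁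
  obtain ⟨υ, u, h₄, h₅, h₆⟩ := h₂ τ h₃
  refine ⟨υ, t + u, .seq h₁ h₄, ?_, h₆⟩
  have := Nat.mul_le_mul_right (1000 * (B + 2) ^ 2) hk
  linarith

lemma Runs.assign_seq {r x : ℕ} {e : Expr} (hσ : σ.Bdd B) (hw : e.wt ≤ 30) (hx : e.eval σ = x)
    (hk : k + 1 ≤ l) (h : Runs ω B q (σ.setReg r x) k Q) : Runs ω B (.seq (.assign r e) q) σ l Q :=
  Runs.seq (R := fun τ => τ = σ.setReg r x) (.assign hσ hw le_rfl (by rw [hx])) (by omega)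
    fun _ hτ => hτ ▸ h

lemma Runs.put_seq {a x y : ℕ} {i e : Expr} (hσ : σ.Bdd B) (hw : i.wt + e.wt ≤ 30)
    (hx : i.eval σ = x) (hy : e.eval σ = y) (hk : k + 1 ≤ l)
    (h : Runs ω B q (σ.setArr a x y) k Q) : Runs ω B (.seq (.put a i e) q) σ l Q :=
  Runs.seq (R := fun τ => τ = σ.setArr a x y) (.put hσ hw le_rfl (by rw [hx, hy])) (by omega)
    fun _ hτ => hτ ▸ h

lemma Runs.flip_seq {r : ℕ} (hk : k + 1 ≤ l) (h : Runs ω B q (σ.flip ω r) k Q) :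
    Runs ω B (.seq (.flip r) q) σ l Q :=
  Runs.seq (R := fun τ => τ = σ.flip ω r) (.flip le_rfl rfl) (by omega) fun _ hτ => hτ ▸ h

lemma Expr.test_le {e : Expr} (hσ : σ.Bdd B) (hw : e.wt ≤ 30) :
    e.cost σ + 1 ≤ 1000 * (B + 2) ^ 2 := by
  have h1 := e.cost_le hσ
  have h3 : e.wt ^ 2 * (B + 2) ^ 2 ≤ 30 ^ 2 * (B + 2) ^ 2 := by gcongr
  have h4 : 1 ≤ (B + 2) ^ 2 := Nat.one_le_pow _ _ (by omega)
  linarith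

lemma Runs.cond {e : Expr} (hσ : σ.Bdd B) (hw : e.wt ≤ 30) (hk : k + 1 ≤ l)
    (h₁ : e.eval σ ≠ 0 → Runs ω B p σ k Q) (h₂ : e.eval σ = 0 → Runs ω B q σ k Q) :
    Runs ω B (.cond e p q) σ l Q := by
  have h3 := Expr.test_le hσ hw
  have h4 := Nat.mul_le_mul_right (1000 * (B + 2) ^ 2) hk
  by_cases he : e.eval σ = 0
  · obtain ⟨τ, t, h5, h6, h7⟩ := h₂ he
    exact ⟨τ, _, .cond_false he h5, by linarith, h7⟩
  · obtain ⟨τ, t, h5, h6, h7⟩ := h₁ he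
    exact ⟨τ, _, .cond_true he h5, by linarith, h7⟩

/-- The rule for loops: `I i` holds after `i` rounds, and there are at most `m` rounds. -/
lemma Runs.loop {e : Expr} (I : ℕ → State → Prop) (hw : e.wt ≤ 30)
    (hI : ∀ i τ, I i τ → τ.Bdd B)
    (hbody : ∀ i τ, I i τ → e.eval τ ≠ 0 → i < m ∧ Runs ω B p τ k (I (i + 1)))
    (h0 : I 0 σ) (hl : m * (k + 1) + 1 ≤ l)
    (hQ : ∀ i τ, I i τ → e.eval τ = 0 → Q τ) : Runs ω B (.loop e p) σ l Q := by
  have key : ∀ d i σ, m ≤ i + d → I i σ → Runs ω B (.loop e p) σ (d * (k + 1) + 1) Q := by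
    intro d
    induction d with
    | zero =>
      intro i σ hd hi
      have he : e.eval σ = 0 := by
        by_contra he
        have := (hbody i σ hi he).1
        omega
      exact ⟨σ, _, .loop_false he, by have := Expr.test_le (hI i σ hi) hw; linarith, hQ i σ hi he⟩
    | succ d ih =>
      intro i σ hd hi
      have h3 := Expr.test_le (hI i σ hi) hw
      by_cases he : e.eval σ = 0
      · refine ⟨σ, _, .loop_false he, ?_, hQ i σ hi he⟩
        nlinarith [Nat.zero_le ((d + 1) * (k + 1) * (1000 * (B + 2) ^ 2))]
      · obtain ⟨_, τ, t, h4, h5, h6⟩ := hbody i σ hi he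
        obtain ⟨υ, u, h7, h8, h9⟩ := ih (i + 1) τ (by omega) h6
        refine ⟨υ, _, .loop_true he h4 h7, ?_, h9⟩
        have : ((d + 1) * (k + 1) + 1) * (1000 * (B + 2) ^ 2) =
            (d * (k + 1) + 1) * (1000 * (B + 2) ^ 2) + k * (1000 * (B + 2) ^ 2) +
              1000 * (B + 2) ^ 2 := by ring
        omega
  exact (key m 0 σ (by omega) h0).mono hl fun _ => id

/-! ### Updated states -/

@[simp] lemma reg_setReg (σ : State) (r v r' : ℕ) :
    (σ.setReg r v).reg r' = if r' = r then v else σ.reg r' := by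
  simp [State.setReg, Function.update_apply]

@[simp] lemma arr_setReg (σ : State) (r v : ℕ) : (σ.setReg r v).arr = σ.arr := rfl

@[simp] lemma used_setReg (σ : State) (r v : ℕ) : (σ.setReg r v).used = σ.used := rfl

@[simp] lemma reg_setArr (σ : State) (a i v : ℕ) : (σ.setArr a i v).reg = σ.reg := rfl

@[simp] lemma used_setArr (σ : State) (a i v : ℕ) : (σ.setArr a i v).used = σ.used := rfl

@[simp] lemma arr_setArr (σ : State) (a i v a' i' : ℕ) :
    (σ.setArr a i v).arr a' i' = if a' = a ∧ i' = i then v else σ.arr a' i' := by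
  by_cases h : a' = a
  · subst h; simp [State.setArr, Function.update_apply]
  · simp [State.setArr, h]

@[simp] lemma reg_flip (σ : State) (r r' : ℕ) :
    (σ.flip ω r).reg r' = if r' = r then (ω σ.used).toNat else σ.reg r' := by
  simp [State.flip, Function.update_apply]

@[simp] lemma arr_flip (σ : State) (r : ℕ) : (σ.flip ω r).arr = σ.arr := rfl

@[simp] lemma used_flip (σ : State) (r : ℕ) : (σ.flip ω r).used = σ.used + 1 := rfl

lemma State.Bdd.setReg {r v : ℕ} (h : σ.Bdd B) (hv : v < 2 ^ B) : (σ.setReg r v).Bdd B :=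
  ⟨fun r' => by rw [reg_setReg]; split_ifs; exacts [hv, h.reg _], h.arr⟩

lemma State.Bdd.setArr {a i v : ℕ} (h : σ.Bdd B) (hv : v < 2 ^ B) : (σ.setArr a i v).Bdd B :=
  ⟨h.reg, fun a' i' => by rw [arr_setArr]; split_ifs; exacts [hv, h.arr _ _]⟩

lemma State.Bdd.flip {r : ℕ} (h : σ.Bdd B) (hB : 1 ≤ B) : (σ.flip ω r).Bdd B := by
  refine ⟨fun r' => ?_, h.arr⟩
  rw [reg_flip]
  split_ifs
  · calc (ω σ.used).toNat < 2 ^ 1 := Bool.toNat_lt _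
      _ ≤ 2 ^ B := Nat.pow_le_pow_right (by norm_num) hB
  · exact h.reg _

end

section

/-! ### Finite sets of naturals as bit masks -/

/-- The bit mask of a finite set of natural numbers. -/
def code (S : Finset ℕ) : ℕ := ∑ i ∈ S, 2 ^ i

lemma code_injective : Function.Injective code := Finset.geomSum_injective le_rfl

lemma code_lt {n : ℕ} {S : Finset ℕ} (h : S ⊆ Finset.range n) : code S < 2 ^ n :=
  Nat.geomSum_lt le_rfl fun _ hk => Finset.mem_range.1 (h hk)

@[simp] lemma code_empty : code ∅ = 0 := rfl

lemma code_insert {S : Finset ℕ} {v : ℕ} (h : v ∉ S) : code (insert v S) = code S + 2 ^ v := by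
  rw [code, Finset.sum_insert h, add_comm]; rfl

lemma code_erase {S : Finset ℕ} {v : ℕ} (h : v ∈ S) : code (S.erase v) = code S - 2 ^ v := by
  have := Finset.sum_erase_add S (fun i => 2 ^ i) h
  simp only [code] at *
  omega

lemma code_range (n : ℕ) : code (Finset.range n) = 2 ^ n - 1 := by
  simpa [code] using Nat.geomSum_eq (m := 2) le_rfl n

lemma code_range_sdiff {n : ℕ} {S : Finset ℕ} (h : S ⊆ Finset.range n) :
    code (Finset.range n \ S) = 2 ^ n - 1 - code S := by
  have := Finset.sum_sdiff (f := fun i => 2 ^ i) h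
  rw [← code_range n]
  simp only [code] at *
  omega

lemma code_div_mod (S : Finset ℕ) (v : ℕ) :
    code S / 2 ^ v % 2 = if v ∈ S then 1 else 0 := by
  have h1 : code S = code (S.filter (· < v)) + (code (S.filter (v < ·)) +
      if v ∈ S then 2 ^ v else 0) := by
    have h2 : S = S.filter (· < v) ∪ (S.filter (v < ·) ∪ S.filter (v = ·)) := by
      ext x; simp only [Finset.mem_union, Finset.mem_filter]
      have := lt_trichotomy x v; tauto
    have h3 : ∑ i ∈ S.filter (v = ·), 2 ^ i = if v ∈ S then 2 ^ v else 0 := by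
      rw [Finset.filter_eq]; split_ifs <;> simp
    rw [← h3]
    conv_lhs => rw [h2]
    rw [code, Finset.sum_union, Finset.sum_union]
    · rfl
    · rw [Finset.disjoint_filter]; intros; omega
    · rw [Finset.disjoint_left]; simp only [Finset.mem_union, Finset.mem_filter]; intro x; omega
  have h4 : code (S.filter (· < v)) < 2 ^ v := code_lt fun x hx => by
    simpa using (Finset.mem_filter.1 hx).2
  obtain ⟨c, hc⟩ : 2 ^ (v + 1) ∣ code (S.filter (v < ·)) := by
    refine Finset.dvd_sum fun i hi => pow_dvd_pow _ ?_
    exact (Finset.mem_filter.1 hi).2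
  rw [h1, hc]
  have h5 : code (S.filter (· < v)) + (2 ^ (v + 1) * c + if v ∈ S then 2 ^ v else 0) =
      code (S.filter (· < v)) + 2 ^ v * (2 * c + if v ∈ S then 1 else 0) := by
    split_ifs <;> ring
  rw [h5, Nat.add_mul_div_left _ _ (by positivity), Nat.div_eq_of_lt h4]
  split_ifs <;> omega

/-! ### Covers by independent sets -/

open Finset

variable (A : ℕ → ℕ → Prop)

/-- `S` contains no pair related by `A`. -/
def Ind (S : Finset ℕ) : Prop := ∀ u ∈ S, ∀ v ∈ S, ¬ A u v

open Classical in
/-- The indicator of independence. -/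
noncomputable def ind (S : Finset ℕ) : ℕ := if Ind A S then 1 else 0

/-- The number of `k`-tuples of independent sets with union `S`. -/
noncomputable def covers : ℕ → Finset ℕ → ℕ
  | 0, S => if S = ∅ then 1 else 0
  | k + 1, S => ∑ p ∈ (S.powerset ×ˢ S.powerset) with p.1 ∪ p.2 = S, covers k p.1 * ind A p.2

/-- The sum of `f` over those subsets of `S` that agree with `S` outside `{0, …, v - 1}`: the state
of the zeta transform once the elements below `v` have been processed. -/
def zetaUpto (f : Finset ℕ → ℕ) (v : ℕ) (S : Finset ℕ) : ℕ :=
  ∑ Y ∈ S.powerset with ∀ x ∈ S, v ≤ x → x ∈ Y, f Y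

/-- The sum of `f` over those subsets of `S` that agree with `S` on `{0, …, v - 1}`: the state
of the Möbius transform once the elements below `v` have been processed. -/
def moebUpto (f : Finset ℕ → ℕ) (v : ℕ) (S : Finset ℕ) : ℕ :=
  ∑ Y ∈ S.powerset with ∀ x ∈ S, x < v → x ∈ Y, f Y

variable {A} {f : Finset ℕ → ℕ} {v n k l : ℕ} {S T : Finset ℕ}

lemma zetaUpto_zero : zetaUpto f 0 S = f S := by
  rw [zetaUpto, Finset.sum_eq_single S]
  · intro Y hY hne
    simp only [mem_filter, mem_powerset] at hY
    exact absurd (hY.1.antisymm fun x hx => hY.2 x hx (Nat.zero_le _)) hne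
  · intro h; exact absurd (by simp) h

lemma zetaUpto_succ_of_notMem (h : v ∉ S) : zetaUpto f (v + 1) S = zetaUpto f v S := by
  refine Finset.sum_congr (Finset.filter_congr fun Y _ => ?_) fun _ _ => rfl
  refine forall₂_congr fun x hx => ?_
  have : x ≠ v := fun e => h (e ▸ hx)
  constructor <;> intro h' h'' <;> exact h' (by omega)

lemma zetaUpto_succ_of_mem (h : v ∈ S) :
    zetaUpto f (v + 1) S = zetaUpto f v S + zetaUpto f v (S.erase v) := by
  rw [zetaUpto, ← Finset.sum_filter_add_sum_filter_not _ (fun Y => v ∈ Y)]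
  congr 1
  · refine Finset.sum_congr ?_ fun _ _ => rfl
    ext Y
    simp only [mem_filter, mem_powerset]
    constructor
    · rintro ⟨⟨h1, h2⟩, h3⟩
      refine ⟨h1, fun x hx hv => ?_⟩
      rcases hv.eq_or_lt with rfl | hv
      · exact h3
      · exact h2 x hx hv
    · rintro ⟨h1, h2⟩
      exact ⟨⟨h1, fun x hx hv => h2 x hx (by omega)⟩, h2 v h le_rfl⟩
  · refine Finset.sum_congr ?_ fun _ _ => rfl
    ext Y
    simp only [mem_filter, mem_powerset, mem_erase, subset_erase]
    constructor
    · rintro ⟨⟨h1, h2⟩, h3⟩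
      exact ⟨⟨h1, h3⟩, fun x hx hv => h2 x hx.2 (by have := hx.1; omega)⟩
    · rintro ⟨⟨h1, h3⟩, h2⟩
      exact ⟨⟨h1, fun x hx hv => h2 x ⟨by omega, hx⟩ (by omega)⟩, h3⟩

lemma zetaUpto_of_subset_range (h : S ⊆ range n) : zetaUpto f n S = ∑ Y ∈ S.powerset, f Y := by
  rw [zetaUpto, Finset.filter_true_of_mem]
  intro Y _ x hx hn
  have := mem_range.1 (h hx)
  omega

lemma moebUpto_zero : moebUpto f 0 S = ∑ Y ∈ S.powerset, f Y := by
  simp [moebUpto]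

lemma moebUpto_succ_of_notMem (h : v ∉ S) : moebUpto f (v + 1) S = moebUpto f v S := by
  refine Finset.sum_congr (Finset.filter_congr fun Y _ => ?_) fun _ _ => rfl
  refine forall₂_congr fun x hx => ?_
  have : x ≠ v := fun e => h (e ▸ hx)
  constructor <;> intro h' h'' <;> exact h' (by omega)

lemma moebUpto_succ_add (h : v ∈ S) :
    moebUpto f (v + 1) S + moebUpto f v (S.erase v) = moebUpto f v S := by
  conv_rhs => rw [moebUpto, ← Finset.sum_filter_add_sum_filter_not _ (fun Y => v ∈ Y)]
  congr 1
  · refine Finset.sum_congr ?_ fun _ _ => rfl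
    ext Y
    simp only [mem_filter, mem_powerset]
    constructor
    · rintro ⟨h1, h2⟩
      exact ⟨⟨h1, fun x hx hv => h2 x hx (by omega)⟩, h2 v h (by omega)⟩
    · rintro ⟨⟨h1, h2⟩, h3⟩
      refine ⟨h1, fun x hx hv => ?_⟩
      rcases (Nat.lt_succ_iff.1 hv).eq_or_lt with rfl | hv
      · exact h3
      · exact h2 x hx hv
  · refine Finset.sum_congr ?_ fun _ _ => rfl
    ext Y
    simp only [mem_filter, mem_powerset, mem_erase, subset_erase]
    constructor
    · rintro ⟨⟨h1, h3⟩, h2⟩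
      exact ⟨⟨h1, fun x hx hv => h2 x ⟨by omega, hx⟩ (by omega)⟩, h3⟩
    · rintro ⟨⟨h1, h2⟩, h3⟩
      exact ⟨⟨h1, h3⟩, fun x hx hv => h2 x hx.2 (by have := hx.1; omega)⟩

/-- Partial inversion never produces a negative number, so truncated subtraction is exact. -/
lemma moebUpto_succ_of_mem (h : v ∈ S) :
    moebUpto f (v + 1) S = moebUpto f v S - moebUpto f v (S.erase v) := by
  have := moebUpto_succ_add (f := f) h
  omega

lemma moebUpto_of_subset_range (h : S ⊆ range n) : moebUpto f n S = f S := by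
  rw [moebUpto, Finset.sum_eq_single S]
  · intro Y hY hne
    simp only [mem_filter, mem_powerset] at hY
    exact absurd (hY.1.antisymm fun x hx => hY.2 x hx (mem_range.1 (h hx))) hne
  · intro h; exact absurd (mem_filter.2 ⟨mem_powerset_self _, fun _ hx _ => hx⟩) h

/-- The zeta transform turns the union product into the pointwise product. -/
lemma sum_powerset_covers (k : ℕ) (S : Finset ℕ) :
    ∑ Y ∈ S.powerset, covers A k Y = (∑ Y ∈ S.powerset, ind A Y) ^ k := by
  induction k with
  | zero => simp [covers]
  | succ k ih =>
    rw [pow_succ, ← ih, Finset.sum_mul_sum, ← Finset.sum_product']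
    rw [← Finset.sum_fiberwise_of_maps_to (s := S.powerset ×ˢ S.powerset) (t := S.powerset)
      (g := fun p => p.1 ∪ p.2)]
    · refine Finset.sum_congr rfl fun Y hY => ?_
      rw [covers]
      refine Finset.sum_congr ?_ fun _ _ => rfl
      ext ⟨a, b⟩
      simp only [mem_filter, mem_product, mem_powerset] at hY ⊢
      constructor
      · rintro ⟨⟨h1, h2⟩, h3⟩
        exact ⟨⟨h1.trans hY, h2.trans hY⟩, h3⟩
      · rintro ⟨-, rfl⟩
        exact ⟨⟨subset_union_left, subset_union_right⟩, rfl⟩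
    · intro p hp
      simp only [mem_product, mem_powerset] at hp ⊢
      exact union_subset hp.1 hp.2

lemma covers_succ_ne_zero :
    covers A (k + 1) S ≠ 0 ↔ ∃ X Y, X ∪ Y = S ∧ covers A k X ≠ 0 ∧ Ind A Y := by
  rw [covers, Ne, Finset.sum_eq_zero_iff]
  push Not
  simp only [mem_filter, mem_product, mem_powerset, ind, mul_ne_zero_iff, Prod.exists]
  constructor
  · rintro ⟨X, Y, ⟨_, h1⟩, h2, h3⟩
    exact ⟨X, Y, h1, h2, by by_contra h; simp [h] at h3⟩
  · rintro ⟨X, Y, rfl, h2, h3⟩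
    exact ⟨X, Y, ⟨⟨subset_union_left, subset_union_right⟩, rfl⟩, h2, by simp [h3]⟩

/-- A proper colouring with colours from `K` gives a cover by `#K` independent sets. -/
lemma covers_ne_zero_of_coloring (K : Finset ℕ) (S : Finset ℕ) (g : ℕ → ℕ)
    (hK : ∀ v ∈ S, g v ∈ K) (hg : ∀ u ∈ S, ∀ v ∈ S, A u v → g u ≠ g v) :
    covers A #K S ≠ 0 := by
  induction K using Finset.induction_on generalizing S with
  | empty =>
    have : S = ∅ := by
      rw [Finset.eq_empty_iff_forall_notMem]; intro v hv; simpa using hK v hv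
    simp [this, covers]
  | insert a K ha ih =>
    rw [card_insert_of_notMem ha, covers_succ_ne_zero]
    refine ⟨S.filter (g · ∈ K), S.filter (g · = a), ?_, ih _ ?_ ?_, ?_⟩
    · ext x
      have := hK x
      simp only [mem_insert, mem_union, mem_filter] at *
      tauto
    · simp
    · simp only [mem_filter]
      exact fun u hu v hv => hg u hu.1 v hv.1
    · intro u hu v hv huv
      simp only [mem_filter] at hu hv
      exact hg u hu.1 v hv.1 huv (hu.2.trans hv.2.symm)

lemma exists_coloring_of_covers_ne_zero (h : covers A k S ≠ 0) :
    ∃ g : ℕ → ℕ, (∀ v ∈ S, g v < k) ∧ ∀ u ∈ S, ∀ v ∈ S, A u v → g u ≠ g v := by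
  induction k generalizing S with
  | zero =>
    have : S = ∅ := by by_contra h'; simp [covers, h'] at h
    simp [this]
  | succ k ih =>
    obtain ⟨X, Y, rfl, hX, hY⟩ := covers_succ_ne_zero.1 h
    obtain ⟨g, h1, h2⟩ := ih hX
    refine ⟨fun v => if v ∈ X then g v else k, fun v hv => ?_, fun u hu v hv huv => ?_⟩
    · by_cases hvX : v ∈ X
      · simpa [hvX] using (h1 v hvX).trans k.lt_succ_self
      · simp [hvX]
    · simp only [mem_union] at hu hv
      by_cases huX : u ∈ X <;> by_cases hvX : v ∈ X <;> simp only [huX, hvX, if_true, if_false]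
      · exact h2 u huX v hvX huv
      · exact (h1 u huX).ne
      · exact (h1 v hvX).ne'
      · exact absurd huv (hY u (by tauto) v (by tauto))

variable (A) in
/-- The number of `k ≤ n` for which `S` has no cover by `k` independent sets; for `S` inside
`{0, …, n - 1}` this is the chromatic number of the graph induced on `S`. -/
noncomputable def chi (n : ℕ) (S : Finset ℕ) : ℕ := #{k ∈ range (n + 1) | covers A k S = 0}

lemma covers_ne_zero_mono (h : covers A k S ≠ 0) (hkl : k ≤ l) : covers A l S ≠ 0 := by
  obtain ⟨g, h1, h2⟩ := exists_coloring_of_covers_ne_zero h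
  simpa using covers_ne_zero_of_coloring (range l) S g
    (fun v hv => mem_range.2 ((h1 v hv).trans_le hkl)) h2

lemma chi_le_of_covers_ne_zero (h : covers A k S ≠ 0) : chi A n S ≤ k := by
  rw [← card_range k]
  refine card_le_card fun l hl => ?_
  simp only [mem_filter, mem_range] at hl ⊢
  by_contra hkl
  exact covers_ne_zero_mono h (not_lt.1 hkl) hl.2

lemma covers_chi_ne_zero (hA : ∀ v, ¬ A v v) (hS : S ⊆ range n) :
    covers A (chi A n S) S ≠ 0 := by
  have hn : covers A n S ≠ 0 := by
    simpa using covers_ne_zero_of_coloring (range n) S id (fun v hv => hS hv)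
      fun u _ v _ h e => hA u (by simpa [show v = u from e.symm] using h)
  intro h0
  have h1 : range (chi A n S + 1) ⊆ {k ∈ range (n + 1) | covers A k S = 0} := by
    intro k hk
    have hkc : k ≤ chi A n S := by simpa [Nat.lt_succ_iff] using hk
    have := chi_le_of_covers_ne_zero (n := n) hn
    simp only [mem_filter, mem_range]
    refine ⟨by omega, ?_⟩
    by_contra hne
    exact covers_ne_zero_mono hne hkc h0
  have := card_le_card h1
  rw [card_range] at this
  exact absurd this (by simp [chi])

lemma sum_powerset_ind_le (h : S ⊆ range n) : ∑ Y ∈ S.powerset, ind A Y ≤ 2 ^ n := by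
  calc ∑ Y ∈ S.powerset, ind A Y ≤ ∑ Y ∈ S.powerset, 1 :=
        sum_le_sum fun Y _ => by rw [ind]; split_ifs <;> simp
    _ = 2 ^ #S := by simp
    _ ≤ 2 ^ n := Nat.pow_le_pow_right (by norm_num) (by simpa using card_le_card h)

lemma moebUpto_covers_le (h : S ⊆ range n) : moebUpto (covers A k) v S ≤ (2 ^ n) ^ k := by
  calc moebUpto (covers A k) v S ≤ ∑ Y ∈ S.powerset, covers A k Y :=
        sum_le_sum_of_subset (filter_subset _ _)
    _ = (∑ Y ∈ S.powerset, ind A Y) ^ k := sum_powerset_covers k S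
    _ ≤ _ := Nat.pow_le_pow_left (sum_powerset_ind_le h) k

lemma zetaUpto_ind_le (h : S ⊆ range n) : zetaUpto (ind A) v S ≤ 2 ^ n :=
  (sum_le_sum_of_subset (filter_subset _ _)).trans (sum_powerset_ind_le h)

end

section

open Finset

/-! ### Program idioms

Registers: `0` and `1` hold the input `n` and `s`, and `0` finally the answer; `2` the number of
samples still to be drawn; `3`, `4` and `14`, `15` a power of two and the vertex it stands for;
`5` a vertex set, `6` its size; `7` the length of the list, `8` a position in it; `9` the number
`2 ^ n`; `10` a number of colours; `12` a truth value; `13` a random bit.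

Arrays: `0` is the adjacency matrix, `1` the list of vertex sets. The others are indexed by
vertex sets: `2` marks the members of the list, `3` counts independent subsets, `4` holds the powers
of these counts and `5` their Möbius transform, and `6` holds chromatic numbers.
-/

/-- The bit of register `x` at the position whose power of two is in register `b`. -/
def bitExpr (x b : ℕ) : Expr := .bin .mod (.bin .div (.reg x) (.reg b)) (.const 2)

/-- Register `r` is increased by one. -/
def incr (r : ℕ) : Prog := .assign r (.bin .add (.reg r) (.const 1))

/-- Register `r` is doubled. -/
def double (r : ℕ) : Prog := .assign r (.bin .add (.reg r) (.reg r))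

/-- Register `r` becomes `2 ^ e`; register `4` is the counter. The value of `e` must not depend on
these two registers. -/
def powTwo (r : ℕ) (e : Expr) : Prog :=
  .seq (.assign r (.const 1)) (.seq (.assign 4 (.const 0))
    (.loop (.bin .lt (.reg 4) e) (.seq (double r) (incr 4))))

/-- Register `v` runs through the vertices `0, …, n - 1`, and register `b` holds `2 ^ v`. -/
def forVertex (v b : ℕ) (p : Prog) : Prog :=
  .seq (.assign b (.const 1)) (.seq (.assign v (.const 0))
    (.loop (.bin .lt (.reg v) (.reg 0)) (.seq p (.seq (double b) (incr v)))))

/-- Register `5` runs through the entries of the list in array `1`, whose length is in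
register `7`. The list may grow meanwhile. Register `8` is the counter. -/
def forList (p : Prog) : Prog :=
  .seq (.assign 8 (.const 0)) (.loop (.bin .lt (.reg 8) (.reg 7))
    (.seq (.assign 5 (.get 1 (.reg 8))) (.seq p (incr 8))))

/-- Append the value of `e` to the list, unless it is there: array `2` marks the members. -/
def insertList (e : Expr) : Prog :=
  .cond (.get 2 e) .skip (.seq (.put 2 e (.const 1)) (.seq (.put 1 (.reg 7) e) (incr 7)))

variable {ω : ℕ → Bool} {B : ℕ} {p q : Prog} {σ : State} {k l m : ℕ} {Q R : State → Prop}

lemma one_lt_two_pow (hB : 1 ≤ B) : 1 < 2 ^ B := Nat.one_lt_two_pow (by omega)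

lemma Runs.powTwo {r E : ℕ} {e : Expr} (hr : r ≠ 4) (hσ : σ.Bdd B) (hE : E < B)
    (he : ∀ x y, e.eval ((σ.setReg r x).setReg 4 y) = E) (hw : e.wt ≤ 20)
    (hl : E * 3 + 3 ≤ l) (hQ : ∀ y < 2 ^ B, Q ((σ.setReg r (2 ^ E)).setReg 4 y)) :
    Runs ω B (powTwo r e) σ l Q := by
  have h1 : 1 < 2 ^ B := one_lt_two_pow (by omega)
  have hpow : ∀ i, i ≤ E → 2 ^ i < 2 ^ B := fun i hi =>
    Nat.pow_lt_pow_right (by norm_num) (by omega)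
  have hlt : ∀ i, i ≤ E → i < 2 ^ B := fun i hi => Nat.lt_two_pow_self.trans (hpow i hi)
  have hb1 := hσ.setReg (r := r) h1
  refine .assign_seq (k := E * 3 + 2) (x := 1) hσ (by simp [Expr.wt]) rfl (by omega) ?_
  refine .assign_seq (k := E * 3 + 1) (x := 0) hb1 (by simp [Expr.wt]) rfl (by omega) ?_
  refine Runs.loop (k := 2) (m := E)
    (fun i τ => i ≤ E ∧ τ = (σ.setReg r (2 ^ i)).setReg 4 i) ?_ ?_ ?_ ?_ ?_ ?_
  · simp [Expr.wt]; omega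
  · rintro i τ ⟨hi, rfl⟩
    exact (hσ.setReg (hpow i hi)).setReg (hlt i hi)
  · rintro i τ ⟨hi, rfl⟩ h
    simp only [Expr.eval, he, BinOp.eval, reg_setReg, if_true] at h
    have hi' : i < E := by by_contra h'; simp [h'] at h
    refine ⟨hi', ?_⟩
    have hb2 := (hσ.setReg (r := r) (hpow i hi)).setReg (r := 4) (hlt i hi)
    refine .assign_seq (k := 1) (x := 2 ^ (i + 1)) hb2 (by simp [Expr.wt]) ?_ le_rfl ?_
    · simp [Expr.eval, BinOp.eval, hr, pow_succ]; ring
    refine .assign (hb2.setReg (hpow _ hi')) (by simp [Expr.wt]) le_rfl ⟨hi', ?_⟩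
    ext x
    · simp only [reg_setReg, Expr.eval, BinOp.eval]
      by_cases h4 : x = 4
      · simp [h4, hr.symm]
      · by_cases h5 : x = r <;> simp [h4, h5, hr]
    · rfl
    · rfl
  · exact ⟨Nat.zero_le _, by simp⟩
  · omega
  · rintro i τ ⟨hi, rfl⟩ h
    simp only [Expr.eval, he, BinOp.eval, reg_setReg, if_true] at h
    have hi' : i = E := by by_contra h'; simp [show i < E by omega] at h
    rw [hi']
    exact hQ E (hlt E le_rfl)

lemma Runs.forVertex {v b n : ℕ} (I : ℕ → State → Prop) (hvb : v ≠ b)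
    (hn : n < B) (hI : ∀ i τ, I i τ → τ.Bdd B ∧ τ.reg 0 = n)
    (hst : ∀ i τ r x, r = b ∨ r = v → x < 2 ^ B → I i τ → I i (τ.setReg r x)) (h0 : I 0 σ)
    (hbody : ∀ i τ, i < n → I i τ → τ.reg v = i → τ.reg b = 2 ^ i →
      Runs ω B p τ k (fun υ => I (i + 1) υ ∧ υ.reg v = i ∧ υ.reg b = 2 ^ i))
    (hl : n * (k + 3) + 3 ≤ l) (hQ : ∀ τ, I n τ → Q τ) : Runs ω B (forVertex v b p) σ l Q := by
  have h1 : 1 < 2 ^ B := one_lt_two_pow (by omega)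
  have hpow : ∀ i, i ≤ n → 2 ^ i < 2 ^ B := fun i hi =>
    Nat.pow_lt_pow_right (by norm_num) (by omega)
  have hlt : ∀ i, i ≤ n → i < 2 ^ B := fun i hi => Nat.lt_two_pow_self.trans (hpow i hi)
  have hσ := (hI _ _ h0).1
  refine .assign_seq (k := n * (k + 3) + 2) (x := 1) hσ (by simp [Expr.wt]) rfl (by omega) ?_
  refine .assign_seq (k := n * (k + 3) + 1) (x := 0) (hσ.setReg h1) (by simp [Expr.wt]) rfl
    (by omega) ?_
  refine Runs.loop (k := k + 2) (m := n)
    (fun i τ => i ≤ n ∧ I i τ ∧ τ.reg v = i ∧ τ.reg b = 2 ^ i) ?_ ?_ ?_ ?_ le_rfl ?_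
  · simp [Expr.wt]
  · exact fun i τ h => (hI _ _ h.2.1).1
  · rintro i τ ⟨hi, h2, h3, h4⟩ h
    simp only [Expr.eval, BinOp.eval, h3, (hI _ _ h2).2] at h
    have hi' : i < n := by by_contra h'; simp [h'] at h
    refine ⟨hi', Runs.seq (hbody i τ hi' h2 h3 h4) le_rfl ?_⟩
    rintro υ ⟨h5, h6, h7⟩
    have h8 : (υ.reg b + υ.reg b) = 2 ^ (i + 1) := by rw [h7]; ring
    refine .assign_seq (k := 1) (x := 2 ^ (i + 1)) (hI _ _ h5).1 (by simp [Expr.wt]) ?_ le_rfl ?_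
    · simp only [Expr.eval, BinOp.eval, h8]
    have h9 := hst _ _ b _ (.inl rfl) (hpow (i + 1) hi') h5
    refine .assign (hI _ _ h9).1 (by simp [Expr.wt]) le_rfl ?_
    simp only [Expr.eval, BinOp.eval, reg_setReg, if_neg hvb, h6]
    exact ⟨hi', hst _ _ v _ (.inr rfl) (hlt _ hi') h9, by simp, by simp [hvb.symm]⟩
  · exact ⟨Nat.zero_le _, hst _ _ v _ (.inr rfl) (by omega) (hst _ _ b _ (.inl rfl) h1 h0),
      by simp, by simp [hvb.symm]⟩
  · rintro i τ ⟨hi, h2, h3, h4⟩ h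
    simp only [Expr.eval, BinOp.eval, h3, (hI _ _ h2).2] at h
    have hi' : i = n := by by_contra h'; simp [show i < n by omega] at h
    exact hQ _ (hi' ▸ h2)

/-- Iteration over a list that the body may extend; `m` bounds its final length. -/
lemma Runs.forList (I : ℕ → State → Prop) (hσ : σ.Bdd B)
    (hI : ∀ i τ, I i τ → τ.Bdd B ∧ τ.reg 8 = i) (h0 : I 0 (σ.setReg 8 0))
    (hbody : ∀ i τ, I i τ → i < τ.reg 7 → i < m ∧ Runs ω B p (τ.setReg 5 (τ.arr 1 i)) k
      (fun υ => υ.Bdd B ∧ υ.reg 8 = i ∧ I (i + 1) (υ.setReg 8 (i + 1))))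
    (hl : m * (k + 3) + 2 ≤ l) (hQ : ∀ i τ, I i τ → τ.reg 7 ≤ i → Q τ) :
    Runs ω B (forList p) σ l Q := by
  refine .assign_seq (k := m * (k + 3) + 1) (x := 0) hσ (by simp [Expr.wt]) rfl (by omega) ?_
  refine Runs.loop (k := k + 2) (m := m) I (by simp [Expr.wt]) (fun i τ h => (hI i τ h).1) ?_ h0
    le_rfl ?_
  · intro i τ h h'
    simp only [Expr.eval, BinOp.eval, (hI _ _ h).2] at h'
    have hi' : i < τ.reg 7 := by by_contra h''; simp [h''] at h'
    obtain ⟨h1, h2⟩ := hbody i τ h hi'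
    refine ⟨h1, .assign_seq (k := k + 1) (x := τ.arr 1 i) (hI i τ h).1 (by simp [Expr.wt]) ?_
      (by omega) ?_⟩
    · simp only [Expr.eval, (hI i τ h).2]
    refine Runs.seq h2 le_rfl ?_
    rintro υ ⟨h3, h4, h5⟩
    refine .assign h3 (by simp [Expr.wt]) le_rfl ?_
    simpa only [Expr.eval, BinOp.eval, h4] using h5
  · intro i τ h h'
    simp only [Expr.eval, BinOp.eval, (hI _ _ h).2] at h'
    exact hQ i τ h (by by_contra h''; simp [not_le.1 h''] at h')

/-! ### The list of vertex sets -/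

/-- What holds throughout: the input is in place, register `9` holds `2 ^ n`, and all numbers
have at most `B` bits. -/
structure Env (n s : ℕ) (A : ℕ → ℕ → Prop) (B : ℕ) (σ : State) : Prop where
  bdd : σ.Bdd B
  r0 : σ.reg 0 = n
  r1 : σ.reg 1 = s
  r9 : σ.reg 9 = 2 ^ n
  adj : ∀ u < n, ∀ v < n, σ.arr 0 (n * u + v) ≠ 0 ↔ A u v

/-- The machine stores the list `D` of subsets of `{0, …, n - 1}`, without repetitions. -/
structure Stores (n : ℕ) (D : List (Finset ℕ)) (σ : State) : Prop where
  len : σ.reg 7 = D.length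
  get : ∀ i (h : i < D.length), σ.arr 1 i = code D[i]
  mark : ∀ S ⊆ range n, σ.arr 2 (code S) = if S ∈ D then 1 else 0
  nodup : D.Nodup
  sub : ∀ S ∈ D, S ⊆ range n

variable {n s : ℕ} {A : ℕ → ℕ → Prop} {D : List (Finset ℕ)} {S : Finset ℕ}

lemma Env.setReg {r x : ℕ} (h : Env n s A B σ) (hr : r ≠ 0 ∧ r ≠ 1 ∧ r ≠ 9) (hx : x < 2 ^ B) :
    Env n s A B (σ.setReg r x) :=
  ⟨h.bdd.setReg hx, by simp [hr.1.symm, h.r0], by simp [hr.2.1.symm, h.r1],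
    by simp [hr.2.2.symm, h.r9], h.adj⟩

lemma Env.setArr {a i x : ℕ} (h : Env n s A B σ) (ha : a ≠ 0) (hx : x < 2 ^ B) :
    Env n s A B (σ.setArr a i x) :=
  ⟨h.bdd.setArr hx, h.r0, h.r1, h.r9, fun u hu v hv => by simpa [ha.symm] using h.adj u hu v hv⟩

lemma Stores.setReg {r x : ℕ} (h : Stores n D σ) (hr : r ≠ 7) : Stores n D (σ.setReg r x) :=
  ⟨by simp [hr.symm, h.len], h.get, h.mark, h.nodup, h.sub⟩

lemma Stores.setArr {a i x : ℕ} (h : Stores n D σ) (h1 : a ≠ 1) (h2 : a ≠ 2) :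
    Stores n D (σ.setArr a i x) :=
  ⟨h.len, fun i hi => by simpa [h1.symm] using h.get i hi,
    fun S hS => by simpa [h2.symm] using h.mark S hS, h.nodup, h.sub⟩

lemma Stores.length_le (h : Stores n D σ) : D.length ≤ 2 ^ n := by
  rw [← List.toFinset_card_of_nodup h.nodup]
  calc #D.toFinset ≤ #(range n).powerset :=
        card_le_card fun S hS => mem_powerset.2 (h.sub S (List.mem_toFinset.1 hS))
    _ = 2 ^ n := by simp

/-- The list `D`, with `S` appended if it is not a member. -/
def insertNew (D : List (Finset ℕ)) (S : Finset ℕ) : List (Finset ℕ) :=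
  if S ∈ D then D else D ++ [S]

@[simp] lemma mem_insertNew {X : Finset ℕ} : X ∈ insertNew D S ↔ X ∈ D ∨ X = S := by
  unfold insertNew; split_ifs with h
  · exact ⟨.inl, fun h' => h'.elim id fun e => e ▸ h⟩
  · simp

lemma prefix_insertNew : D <+: insertNew D S := by
  unfold insertNew; split_ifs
  · exact List.prefix_refl _
  · exact List.prefix_append _ _

/-- The two states differ at most in the stored list. -/
structure SameButList (σ τ : State) : Prop where
  reg : ∀ r, r ≠ 7 → τ.reg r = σ.reg r
  arr : ∀ a, a ≠ 1 → a ≠ 2 → τ.arr a = σ.arr a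
  used : τ.used = σ.used

lemma Runs.insertList {e : Expr} (hB : n < B) (hE : Env n s A B σ) (hD : Stores n D σ)
    (he : ∀ τ, SameButList σ τ → e.eval τ = code S) (hS : S ⊆ range n) (hw : e.wt ≤ 20)
    (hk : 4 ≤ k) : Runs ω B (insertList e) σ k fun τ =>
      Env n s A B τ ∧ Stores n (insertNew D S) τ ∧ SameButList σ τ := by
  have h1 : 1 < 2 ^ B := one_lt_two_pow (by omega)
  have hpow : 2 ^ n < 2 ^ B := Nat.pow_lt_pow_right (by norm_num) hB
  have hr : SameButList σ σ := ⟨fun _ _ => rfl, fun _ _ _ => rfl, rfl⟩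
  refine Runs.cond (k := 3) hE.bdd (by simp [Expr.wt]; omega) (by omega) ?_ ?_
  · intro h
    simp only [Expr.eval, he σ hr, hD.mark S hS] at h
    have hm : S ∈ D := by by_contra h'; simp [h'] at h
    refine .skip (by omega) ⟨hE, ?_, hr⟩
    rwa [insertNew, if_pos hm]
  · intro h
    simp only [Expr.eval, he σ hr, hD.mark S hS] at h
    have hm : S ∉ D := by intro h'; simp [h'] at h
    have hE1 := hE.setArr (a := 2) (i := code S) (by norm_num) h1
    have hs1 : SameButList σ (σ.setArr 2 (code S) 1) :=
      ⟨fun _ _ => rfl, fun a h1 h2 => by ext i; simp [h2], rfl⟩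
    refine .put_seq (k := 2) hE.bdd (by simp [Expr.wt]; omega) (he σ hr) rfl (by omega) ?_
    refine .put_seq (k := 1) (x := D.length) hE1.bdd (by simp [Expr.wt]; omega) ?_ (he _ hs1)
      le_rfl ?_
    · simp only [Expr.eval, reg_setArr, hD.len]
    have hE2 := hE1.setArr (a := 1) (i := D.length) (by norm_num) ((code_lt hS).trans hpow)
    refine .assign hE2.bdd (by simp [Expr.wt]) le_rfl ?_
    have hst : Stores n (insertNew D S)
        (((σ.setArr 2 (code S) 1).setArr 1 D.length (code S)).setReg 7 (D.length + 1)) := by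
      rw [insertNew, if_neg hm]
      refine ⟨by simp, fun i hi => ?_, fun T hT => ?_, ?_, ?_⟩
      · simp only [List.length_append, List.length_singleton] at hi
        rcases (Nat.lt_succ_iff.1 hi).eq_or_lt with rfl | hi'
        · simp
        · simp [hi'.ne, List.getElem_append_left hi', hD.get i hi']
      · by_cases hTS : T = S
        · simp [hTS]
        · have : code T ≠ code S := fun h => hTS (code_injective h)
          simp [hTS, this, hD.mark T hT]
      · rw [List.nodup_append]
        refine ⟨hD.nodup, List.nodup_singleton _, ?_⟩
        rintro a ha b hb rfl
        simp only [List.mem_singleton] at hb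
        exact hm (hb ▸ ha)
      · simp only [List.mem_append, List.mem_singleton]
        rintro T (hT | rfl)
        exacts [hD.sub T hT, hS]
    simp only [Expr.eval, BinOp.eval, reg_setArr, hD.len]
    refine ⟨hE2.setReg (by norm_num) ?_, hst, fun r hr => by simp [hr], fun a h1 h2 => ?_, rfl⟩
    · have := hst.length_le
      simp only [insertNew, if_neg hm, List.length_append, List.length_singleton] at this
      omega
    · ext i; simp [h1, h2]

end

section

open Finset

variable {ω : ℕ → Bool} {B : ℕ} {p q : Prog} {σ : State} {k l m : ℕ} {Q R : State → Prop}
variable {n s N : ℕ} {A : ℕ → ℕ → Prop} {D : List (Finset ℕ)} {S : Finset ℕ}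

/-! ### Sampling -/

/-- The bit mask of the complement of the set in register `5`. -/
def complExpr : Expr := .bin .sub (.bin .sub (.reg 9) (.const 1)) (.reg 5)

/-- Draw a random set of vertices into register `5`, and its size into register `6`. -/
def drawProg : Prog :=
  .seq (.assign 5 (.const 0)) (.seq (.assign 6 (.const 0))
    (forVertex 4 3 (.seq (.flip 13)
      (.cond (.reg 13) (.seq (.assign 5 (.bin .add (.reg 5) (.reg 3))) (incr 6)) .skip))))

/-- Draw as many random sets as register `2` says, and store those of size `n / 2` together with
their complements. -/
def sampleProg : Prog :=
  .loop (.reg 2) (.seq drawProg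
    (.seq (.cond (.bin .eq (.reg 6) (.bin .div (.reg 0) (.const 2)))
        (.seq (insertList (.reg 5)) (insertList complExpr)) .skip)
      (.assign 2 (.bin .sub (.reg 2) (.const 1)))))

/-- The `j`-th random subset of `{0, …, n - 1}` on the tape `ω`. -/
def sample (ω : ℕ → Bool) (n j : ℕ) : Finset ℕ := {v ∈ range n | ω (j * n + v) = true}

/-- `X` is one of the first `N` samples, or the complement of one, and that sample has
`n / 2` elements. -/
def IsHalf (ω : ℕ → Bool) (n N : ℕ) (X : Finset ℕ) : Prop :=
  ∃ j < N, #(sample ω n j) = n / 2 ∧ (X = sample ω n j ∨ X = range n \ sample ω n j)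

lemma sample_subset (ω : ℕ → Bool) (n j : ℕ) : sample ω n j ⊆ range n := filter_subset _ _

lemma IsHalf.subset {X : Finset ℕ} (h : IsHalf ω n N X) : X ⊆ range n := by
  obtain ⟨j, -, -, rfl | rfl⟩ := h
  exacts [sample_subset _ _ _, sdiff_subset]

lemma Runs.draw {j y : ℕ} (hB : n + 1 < B) (hE : Env n s A B σ) (hD : Stores n D σ)
    (hu : σ.used = j * n) (hy : σ.reg 2 = y) (hk : n * 7 + 5 ≤ k) :
    Runs ω B drawProg σ k fun τ => Env n s A B τ ∧ Stores n D τ ∧ τ.used = (j + 1) * n ∧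
      τ.reg 2 = y ∧ τ.reg 5 = code (sample ω n j) ∧ τ.reg 6 = #(sample ω n j) := by
  have hpow : 2 ^ n < 2 ^ B := Nat.pow_lt_pow_right (by norm_num) (by omega)
  have hnB : n < 2 ^ B := Nat.lt_two_pow_self.trans hpow
  have hE1 := hE.setReg (r := 5) (x := 0) (by norm_num) (by positivity)
  refine .assign_seq (k := n * 7 + 4) hE.bdd (by simp [Expr.wt]) rfl (by omega) ?_
  refine .assign_seq (k := n * 7 + 3) hE1.bdd (by simp [Expr.wt]) rfl (by omega) ?_
  refine Runs.forVertex (k := 4) (fun i τ => Env n s A B τ ∧ Stores n D τ ∧ τ.used = j * n + i ∧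
      τ.reg 2 = y ∧ τ.reg 5 = code ((range i).filter fun v => ω (j * n + v) = true) ∧
      τ.reg 6 = #((range i).filter fun v => ω (j * n + v) = true))
    (by norm_num) (by omega) (fun i τ h => ⟨h.1.bdd, h.1.r0⟩) ?_ ?_ ?_ (by omega) ?_
  · rintro i τ r x (rfl | rfl) hx ⟨h1, h2, h3, h4, h5, h6⟩ <;>
      exact ⟨h1.setReg (by norm_num) hx, h2.setReg (by norm_num), h3, by simp [h4], by simp [h5],
        by simp [h6]⟩
  · exact ⟨hE1.setReg (by norm_num) (by positivity),
      (hD.setReg (by norm_num)).setReg (by norm_num), by simp [hu], by simp [hy],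
      by simp [Expr.eval], by simp [Expr.eval]⟩
  · rintro i τ hi ⟨h1, h2, h3, h4, h5, h6⟩ h7 h8
    have hE2 : Env n s A B (τ.flip ω 13) :=
      ⟨h1.bdd.flip (by omega), by simp [h1.r0], by simp [h1.r1], by simp [h1.r9], h1.adj⟩
    have hD2 : Stores n D (τ.flip ω 13) := ⟨by simp [h2.len], h2.get, h2.mark, h2.nodup, h2.sub⟩
    have hmem : i ∉ (range i).filter fun v => ω (j * n + v) = true := by simp
    have hsub : (range (i + 1)).filter (fun v => ω (j * n + v) = true) ⊆ range n := fun x hx => by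
      have := mem_range.1 (mem_filter.1 hx).1
      exact mem_range.2 (by omega)
    refine .flip_seq (k := 3) le_rfl ?_
    refine .cond (k := 2) hE2.bdd (by simp [Expr.wt]) le_rfl ?_ ?_
    · intro h
      have hω : ω (j * n + i) = true := by simpa [Expr.eval, h3] using h
      have hS : (range (i + 1)).filter (fun v => ω (j * n + v) = true) =
          insert i ((range i).filter fun v => ω (j * n + v) = true) := by
        rw [range_add_one, filter_insert, if_pos hω]
      have h9 : code ((range (i + 1)).filter fun v => ω (j * n + v) = true) =
          τ.reg 5 + τ.reg 3 := by rw [hS, code_insert hmem, h5, h8]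
      have h10 : #((range (i + 1)).filter fun v => ω (j * n + v) = true) = τ.reg 6 + 1 := by
        rw [hS, card_insert_of_notMem hmem, h6]
      have hE3 := hE2.setReg (r := 5) (by norm_num) ((code_lt hsub).trans hpow)
      refine .assign_seq (k := 1) (x := code ((range (i + 1)).filter fun v => ω (j * n + v) = true))
        hE2.bdd (by simp [Expr.wt]) (by simp [Expr.eval, BinOp.eval, h9]) le_rfl ?_
      refine .assign hE3.bdd (by simp [Expr.wt]) le_rfl ?_
      have h11 : #((range (i + 1)).filter fun v => ω (j * n + v) = true) < 2 ^ B :=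
        (by simpa using card_le_card hsub : _ ≤ n).trans_lt hnB
      simp only [Expr.eval, BinOp.eval, reg_setReg, reg_flip]
      refine ⟨⟨hE3.setReg (by norm_num) (by simpa [h10] using h11),
        (hD2.setReg (by norm_num)).setReg (by norm_num), by simp [h3, add_assoc],
        by simp [h4], by simp, ?_⟩, by simp [h7], by simp [h8]⟩
      simp [h10]
    · intro h
      have hω : ω (j * n + i) = false := by simpa [Expr.eval, h3] using h
      have hS : (range (i + 1)).filter (fun v => ω (j * n + v) = true) =
          ((range i).filter fun v => ω (j * n + v) = true) := by
        rw [range_add_one, filter_insert, if_neg (by simp [hω])]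
      refine .skip (by norm_num) ⟨⟨hE2, hD2, by simp [h3, add_assoc], by simp [h4], ?_, ?_⟩,
        by simp [h7], by simp [h8]⟩
      · rw [hS]; simp [h5]
      · rw [hS]; simp [h6]
  · rintro τ ⟨h1, h2, h3, h4, h5, h6⟩
    exact ⟨h1, h2, by rw [h3]; ring, h4, h5, h6⟩

lemma SameButList.trans {σ τ υ : State} (h : SameButList σ τ) (h' : SameButList τ υ) :
    SameButList σ υ :=
  ⟨fun r hr => (h'.reg r hr).trans (h.reg r hr),
    fun a h1 h2 => (h'.arr a h1 h2).trans (h.arr a h1 h2),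
    h'.used.trans h.used⟩

lemma complExpr_eval (h9 : σ.reg 9 = 2 ^ n) (h5 : σ.reg 5 = code S) (hS : S ⊆ range n) :
    complExpr.eval σ = code (range n \ S) := by
  simp [complExpr, Expr.eval, BinOp.eval, h9, h5, code_range_sdiff hS]

lemma Runs.sample (hB : n + 1 < B) (hE : Env n s A B σ) (hD : Stores n [] σ)
    (hu : σ.used = 0) (hN : σ.reg 2 = N) (hk : N * (n * 7 + 16) + 1 ≤ k) :
    Runs ω B sampleProg σ k fun τ => Env n s A B τ ∧
      ∃ D, Stores n D τ ∧ ∀ X, X ∈ D ↔ IsHalf ω n N X := by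
  have hpow : 2 ^ n < 2 ^ B := Nat.pow_lt_pow_right (by norm_num) (by omega)
  have hNB : N < 2 ^ B := hN ▸ hE.bdd.reg 2
  refine Runs.loop (k := n * 7 + 15) (m := N) (fun i τ => i ≤ N ∧ Env n s A B τ ∧
    τ.used = i * n ∧ τ.reg 2 = N - i ∧ ∃ D, Stores n D τ ∧ ∀ X, X ∈ D ↔ IsHalf ω n i X)
    (by simp [Expr.wt]) (fun i τ h => h.2.1.bdd) ?_ ?_ (by omega) ?_
  · rintro i τ ⟨hi, h1, h2, h3, D, h4, h5⟩ h
    simp only [Expr.eval, h3] at h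
    have hi' : i < N := by omega
    have hstep : ∀ X, IsHalf ω n (i + 1) X ↔ IsHalf ω n i X ∨ (#(RandRAM.sample ω n i) = n / 2 ∧
        (X = RandRAM.sample ω n i ∨ X = range n \ RandRAM.sample ω n i)) := by
      intro X
      constructor
      · rintro ⟨j, hj, hjX⟩
        rcases (Nat.lt_succ_iff.1 hj).eq_or_lt with rfl | hj
        exacts [.inr hjX, .inl ⟨j, hj, hjX⟩]
      · rintro (⟨j, hj, h⟩ | h)
        exacts [⟨j, by omega, h⟩, ⟨i, by omega, h⟩]
    refine ⟨hi', Runs.seq (k := n * 7 + 5) (l := 10)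
      (Runs.draw hB h1 h4 h2 h3 le_rfl) (by omega) ?_⟩
    rintro τ ⟨h6, h7, h8, h9, h10, h11⟩
    have hsub := sample_subset ω n i
    refine Runs.seq (k := 9) (l := 1) (R := fun υ => Env n s A B υ ∧
      υ.used = (i + 1) * n ∧ υ.reg 2 = N - i ∧
      ∃ D, Stores n D υ ∧ ∀ X, X ∈ D ↔ IsHalf ω n (i + 1) X)
      (.cond (k := 8) h6.bdd (by simp [Expr.wt]; decide) le_rfl ?_ ?_) le_rfl ?_
    · intro h
      simp only [Expr.eval, BinOp.eval, h6.r0, h11, ne_eq, ite_eq_right_iff, one_ne_zero, imp_false,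
        not_not] at h
      refine Runs.seq (k := 4) (l := 4)
        (Runs.insertList (by omega) h6 h7 (S := RandRAM.sample ω n i) (fun υ hυ => ?_)
          hsub (by simp [Expr.wt]) le_rfl) le_rfl ?_
      · simp [Expr.eval, hυ.reg, h10]
      rintro υ ⟨h12, h13, h14⟩
      refine (Runs.insertList (k := 4) (by omega) h12 h13 (S := range n \ RandRAM.sample ω n i)
        (fun υ' hυ' => ?_) sdiff_subset (by simp [complExpr, Expr.wt]) le_rfl).mono le_rfl ?_
      · have h15 := h14.trans hυ'
        exact complExpr_eval (by simp [h15.reg, h6.r9]) (by simp [h15.reg, h10]) hsub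
      rintro υ' ⟨h16, h17, h18⟩
      have h15 := h14.trans h18
      refine ⟨h16, by rw [h15.used, h8], by simp [h15.reg, h9], _, h17, fun X => ?_⟩
      rw [hstep, mem_insertNew, mem_insertNew, h5, or_assoc]
      simp [h]
    · intro h
      simp only [Expr.eval, BinOp.eval, h6.r0, h11, ite_eq_right_iff, one_ne_zero, imp_false] at h
      refine .skip (by norm_num) ⟨h6, h8, h9, D, h7, fun X => ?_⟩
      rw [hstep, h5]
      tauto
    · rintro υ ⟨h12, h13, h14, D', h15, h16⟩
      refine .assign h12.bdd (by simp [Expr.wt]) le_rfl ?_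
      simp only [Expr.eval, BinOp.eval, h14]
      exact ⟨hi', h12.setReg (by norm_num) (by omega), h13, by simp; omega, D',
        h15.setReg (by norm_num), h16⟩
  · refine ⟨Nat.zero_le _, hE, by simp [hu], by simp [hN], [], hD, fun X => ?_⟩
    simp [IsHalf]
  · rintro i τ ⟨hi, h1, h2, h3, D, h4, h5⟩ h
    simp only [Expr.eval, h3] at h
    have hi' : i = N := by omega
    subst hi'
    exact ⟨h1, D, h4, h5⟩

/-! ### Closure under removing elements -/

/-- Append to the list all sets that arise by removing elements. -/
def closureProg : Prog :=
  forList (forVertex 4 3 (.cond (bitExpr 5 3) (insertList (.bin .sub (.reg 5) (.reg 3))) .skip))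

lemma bitExpr_eval {x b v : ℕ} (hx : σ.reg x = code S) (hb : σ.reg b = 2 ^ v) :
    (bitExpr x b).eval σ = if v ∈ S then 1 else 0 := by
  simp [bitExpr, Expr.eval, BinOp.eval, hx, hb, code_div_mod]

lemma bitExpr_wt (x b : ℕ) : (bitExpr x b).wt = 5 := by simp [bitExpr, Expr.wt]; decide

lemma mem_of_subset_of_erase_mem {D : List (Finset ℕ)} (hD : ∀ X ∈ D, ∀ v ∈ X, X.erase v ∈ D)
    {X Y : Finset ℕ} (hX : X ∈ D) (hYX : Y ⊆ X) : Y ∈ D := by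
  induction hd : #(X \ Y) generalizing X with
  | zero =>
    have : X ⊆ Y := by simpa using hd
    rwa [hYX.antisymm this]
  | succ d ih =>
    obtain ⟨v, hv⟩ : (X \ Y).Nonempty := by rw [← card_pos]; omega
    have hv' := mem_sdiff.1 hv
    refine ih (hD X hX v hv'.1) (fun x hx => mem_erase.2 ⟨?_, hYX hx⟩) ?_
    · rintro rfl; exact hv'.2 hx
    · rw [erase_sdiff_comm, card_erase_of_mem hv, hd]; rfl

/-- The closure step visits each member of the down-closure `𝒟` of the stored sets once. -/
lemma Runs.closure {H : Finset ℕ → Prop} (hB : n + 1 < B) (hE : Env n s A B σ)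
    (hD : Stores n D σ) (hH : ∀ X, X ∈ D ↔ H X) (𝒟 : Finset (Finset ℕ))
    (h𝒟 : ∀ X, X ∈ 𝒟 ↔ ∃ Y, H Y ∧ X ⊆ Y) (hm : #𝒟 = m) (hk : m * (n * 8 + 6) + 2 ≤ k) :
    Runs ω B closureProg σ k fun τ => Env n s A B τ ∧
      ∃ D, Stores n D τ ∧ D.length = m ∧ ∀ X, X ∈ D ↔ X ∈ 𝒟 := by
  have hpow : 2 ^ n < 2 ^ B := Nat.pow_lt_pow_right (by norm_num) (by omega)
  have hle : ∀ {D : List (Finset ℕ)}, D.Nodup → (∀ X ∈ D, X ∈ 𝒟) → D.length ≤ m := by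
    intro D h1 h2
    rw [← List.toFinset_card_of_nodup h1, ← hm]
    exact card_le_card fun X hX => h2 X (List.mem_toFinset.1 hX)
  refine Runs.forList (k := n * 8 + 3) (m := m) (fun i τ => Env n s A B τ ∧ τ.reg 8 = i ∧
    ∃ D, Stores n D τ ∧ (∀ X, H X → X ∈ D) ∧ (∀ X ∈ D, X ∈ 𝒟) ∧
      ∀ j < i, ∀ h : j < D.length, ∀ v ∈ D[j], D[j].erase v ∈ D)
    hE.bdd (fun i τ h => ⟨h.1.bdd, h.2.1⟩) ?_ ?_ (by omega) ?_
  · exact ⟨hE.setReg (by norm_num) (by positivity), by simp, D, hD.setReg (by norm_num),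
      fun X hX => (hH X).2 hX, fun X hX => (h𝒟 X).2 ⟨X, (hH X).1 hX, subset_rfl⟩,
      fun j hj => absurd hj (Nat.not_lt_zero _)⟩
  · rintro i τ ⟨h1, h2, D, h3, h4, h5, h6⟩ hi
    rw [h3.len] at hi
    have him := hi.trans_le (hle h3.nodup h5)
    refine ⟨him, ?_⟩
    rw [h3.get i hi]
    set X := D[i] with hX
    have hXD : X ∈ D := List.getElem_mem hi
    have hXn := h3.sub X hXD
    refine Runs.forVertex (k := 5) (fun v υ => Env n s A B υ ∧ υ.reg 8 = i ∧ υ.reg 5 = code X ∧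
      ∃ D', Stores n D' υ ∧ D <+: D' ∧ (∀ X ∈ D', X ∈ 𝒟) ∧ ∀ u ∈ X, u < v → X.erase u ∈ D')
      (by norm_num) (by omega) (fun i τ h => ⟨h.1.bdd, h.1.r0⟩) ?_ ?_ ?_ (by omega) ?_
    · rintro v υ r x (rfl | rfl) hx ⟨g1, g2, g3, D', g4, g5⟩ <;>
      exact ⟨g1.setReg (by norm_num) hx, by simp [g2], by simp [g3], D',
        g4.setReg (by norm_num), g5⟩
    · exact ⟨h1.setReg (by norm_num) ((code_lt hXn).trans hpow), by simp [h2], by simp, D,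
        h3.setReg (by norm_num), List.prefix_refl _, h5,
        fun u _ hu => absurd hu (Nat.not_lt_zero _)⟩
    · rintro v υ hv ⟨g1, g2, g3, D', g4, g5, g6, g7⟩ g8 g9
      have hbit := bitExpr_eval (σ := υ) (x := 5) (b := 3) g3 g9
      refine .cond (k := 4) g1.bdd (by simp [bitExpr_wt]) le_rfl ?_ ?_
      · intro h
        have hvX : v ∈ X := by by_contra h'; simp [hbit, h'] at h
        refine (Runs.insertList (k := 4) (S := X.erase v) (by omega) g1 g4 (fun υ' hυ' => ?_)
          ((erase_subset _ _).trans hXn) (by simp [Expr.wt]) le_rfl).mono le_rfl ?_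
        · simp [Expr.eval, BinOp.eval, hυ'.reg, g3, g9, code_erase hvX]
        rintro υ' ⟨f1, f2, f3⟩
        refine ⟨⟨f1, by simp [f3.reg, g2], by simp [f3.reg, g3], _, f2,
          g5.trans prefix_insertNew, ?_, ?_⟩, by simp [f3.reg, g8], by simp [f3.reg, g9]⟩
        · intro Y hY
          rw [mem_insertNew] at hY
          rcases hY with hY | rfl
          · exact g6 Y hY
          · obtain ⟨Z, hZ, hZ'⟩ := (h𝒟 X).1 (h5 X hXD)
            exact (h𝒟 _).2 ⟨Z, hZ, (erase_subset _ _).trans hZ'⟩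
        · intro u hu huv
          rw [mem_insertNew]
          rcases (Nat.lt_succ_iff.1 huv).eq_or_lt with rfl | h'
          exacts [.inr rfl, .inl (g7 u hu h')]
      · intro h
        have hvX : v ∉ X := by intro h'; simp [hbit, h'] at h
        refine .skip (by norm_num)
          ⟨⟨g1, g2, g3, D', g4, g5, g6, fun u hu huv => g7 u hu ?_⟩, g8, g9⟩
        have : u ≠ v := fun e => hvX (e ▸ hu)
        omega
    · rintro υ ⟨g1, g2, g3, D', g4, g5, g6, g7⟩
      have hnB : m < 2 ^ B := by
        have : #𝒟 ≤ #(range n).powerset := card_le_card fun X hX => by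
          obtain ⟨Y, hY, hXY⟩ := (h𝒟 X).1 hX
          exact mem_powerset.2 (hXY.trans (hD.sub Y ((hH Y).2 hY)))
        simp only [card_powerset, card_range, hm] at this
        omega
      refine ⟨g1.bdd, g2, g1.setReg (by norm_num) (by omega), by simp, D', g4.setReg (by norm_num),
        fun Y hY => g5.subset (h4 Y hY), g6, fun j hj hj' v hv => ?_⟩
      have hpre : ∀ j (h : j < D.length) (h' : j < D'.length), D'[j] = D[j] := fun j h h' =>
        (g5.getElem h).symm
      rcases (Nat.lt_succ_iff.1 hj).eq_or_lt with rfl | hj''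
      · rw [hpre j hi, ← hX] at hv ⊢
        exact g7 v hv (mem_range.1 (hXn hv))
      · rw [hpre j (hj''.trans hi)] at hv ⊢
        exact g5.subset (h6 j hj'' _ v hv)
  · rintro i τ ⟨h1, h2, D, h3, h4, h5, h6⟩ hi
    rw [h3.len] at hi
    have hcl : ∀ X ∈ D, ∀ v ∈ X, X.erase v ∈ D := by
      intro X hX v hv
      obtain ⟨j, hj, rfl⟩ := List.getElem_of_mem hX
      exact h6 j (hj.trans_le hi) hj v hv
    have hiff : ∀ X, X ∈ D ↔ X ∈ 𝒟 := fun X => ⟨h5 X, fun hX => by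
      obtain ⟨Y, hY, hXY⟩ := (h𝒟 X).1 hX
      exact mem_of_subset_of_erase_mem hcl (h4 Y hY) hXY⟩
    refine ⟨h1, D, h3, ?_, hiff⟩
    rw [← hm, ← List.toFinset_card_of_nodup h3.nodup]
    congr 1
    ext X
    simp [hiff]

end

section

open Finset

variable {ω : ℕ → Bool} {B : ℕ} {p q : Prog} {σ : State} {k l m : ℕ} {Q R : State → Prop}
variable {n s N : ℕ} {A : ℕ → ℕ → Prop} {D : List (Finset ℕ)} {S : Finset ℕ}

/-! ### Tables indexed by the stored sets -/

/-- Array `a` holds the value `F X` at the code of every stored set `X`. -/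
def Tabulates (D : List (Finset ℕ)) (a : ℕ) (F : Finset ℕ → ℕ) (σ : State) : Prop :=
  ∀ X ∈ D, σ.arr a (code X) = F X

/-- Array `a` holds `F' X` for the first `i` stored sets `X` and `F X` for the others. -/
def TabulatesUpto (D : List (Finset ℕ)) (a i : ℕ) (F' F : Finset ℕ → ℕ) (σ : State) : Prop :=
  ∀ j (h : j < D.length), σ.arr a (code D[j]) = if j < i then F' D[j] else F D[j]

variable {a i x : ℕ} {F F' : Finset ℕ → ℕ}

lemma Tabulates.upto (h : Tabulates D a F σ) : TabulatesUpto D a 0 F' F σ := fun j hj => by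
  simpa using h _ (List.getElem_mem hj)

lemma TabulatesUpto.tabulates (h : TabulatesUpto D a D.length F' F σ) : Tabulates D a F' σ := by
  intro X hX
  obtain ⟨j, hj, rfl⟩ := List.getElem_of_mem hX
  simpa [hj] using h j hj

lemma TabulatesUpto.put (hD : D.Nodup) (h : TabulatesUpto D a i F' F σ) (hi : i < D.length)
    (hx : x = F' D[i]) :
    TabulatesUpto D a (i + 1) F' F (σ.setArr a (code D[i]) x) := by
  intro j hj
  rw [arr_setArr]
  by_cases hji : j = i
  · subst hji; simp [hx]
  · have h1 : code D[j] ≠ code D[i] := fun e => hji ((hD.getElem_inj_iff).1 (code_injective e))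
    rw [if_neg (by simp [h1]), h j hj]
    have : j < i + 1 ↔ j < i := by omega
    simp [this]

lemma TabulatesUpto.keep (h : TabulatesUpto D a i F' F σ) (hi : i < D.length)
    (hx : F' D[i] = F D[i]) : TabulatesUpto D a (i + 1) F' F σ := by
  intro j hj
  rw [h j hj]
  by_cases hji : j = i
  · subst hji; simp [hx]
  · have : j < i + 1 ↔ j < i := by omega
    simp [this]

lemma Tabulates.setArr {b j y : ℕ} (h : Tabulates D a F σ) (hb : a ≠ b) :
    Tabulates D a F (σ.setArr b j y) := fun X hX => by simpa [hb] using h X hX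

lemma TabulatesUpto.setArr {b j y : ℕ} (h : TabulatesUpto D a i F' F σ) (hb : a ≠ b) :
    TabulatesUpto D a i F' F (σ.setArr b j y) := fun X hX => by simpa [hb] using h X hX

/-- The general state of the machine once the list is complete. -/
structure Ctx (n s : ℕ) (A : ℕ → ℕ → Prop) (B : ℕ) (D : List (Finset ℕ)) (σ : State) : Prop where
  env : Env n s A B σ
  stores : Stores n D σ

lemma Ctx.setReg {r : ℕ} (h : Ctx n s A B D σ) (hr : (r ≠ 0 ∧ r ≠ 1 ∧ r ≠ 9) ∧ r ≠ 7)
    (hx : x < 2 ^ B) : Ctx n s A B D (σ.setReg r x) :=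
  ⟨h.env.setReg hr.1 hx, h.stores.setReg hr.2⟩

lemma Ctx.setArr {j : ℕ} (h : Ctx n s A B D σ) (ha : a ≠ 0 ∧ a ≠ 1 ∧ a ≠ 2)
    (hx : x < 2 ^ B) : Ctx n s A B D (σ.setArr a j x) :=
  ⟨h.env.setArr ha.1 hx, h.stores.setArr ha.2.1 ha.2.2⟩

/-- Iteration over a list that stays as it is. -/
lemma Runs.forEach (hB : n + 1 < B) (I : ℕ → State → Prop)
    (hI : ∀ i τ, I i τ → Ctx n s A B D τ)
    (hst : ∀ i τ r x, r = 5 ∨ r = 8 → x < 2 ^ B → I i τ → I i (τ.setReg r x)) (h0 : I 0 σ)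
    (hbody : ∀ i τ (hi : i < D.length), I i τ → τ.reg 5 = code D[i] →
      Runs ω B p τ k fun υ => I (i + 1) υ ∧ υ.reg 8 = τ.reg 8)
    (hl : D.length * (k + 3) + 2 ≤ l) (hQ : ∀ τ, I D.length τ → Q τ) :
    Runs ω B (RandRAM.forList p) σ l Q := by
  have hpow : 2 ^ n < 2 ^ B := Nat.pow_lt_pow_right (by norm_num) (by omega)
  have hlen := (hI _ _ h0).stores.length_le
  refine Runs.forList (k := k) (m := D.length) (fun i τ => i ≤ D.length ∧ I i τ ∧ τ.reg 8 = i)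
    (hI _ _ h0).env.bdd (fun i τ h => ⟨(hI _ _ h.2.1).env.bdd, h.2.2⟩)
    ⟨Nat.zero_le _, hst _ _ _ _ (.inr rfl) (by positivity) h0, by simp⟩ ?_ hl ?_
  · rintro i τ ⟨hi, h1, h2⟩ hi'
    have hC := hI _ _ h1
    rw [hC.stores.len] at hi'
    refine ⟨hi', ?_⟩
    rw [hC.stores.get i hi']
    have hlt : code D[i] < 2 ^ B :=
      (code_lt (hC.stores.sub _ (List.getElem_mem hi'))).trans hpow
    refine (hbody i _ hi' (hst _ _ _ _ (.inl rfl) hlt h1) (by simp)).mono le_rfl ?_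
    rintro υ ⟨h3, h4⟩
    exact ⟨(hI _ _ h3).env.bdd, by simp [h4, h2], hi',
      hst _ _ _ _ (.inr rfl) (by omega) h3, by simp⟩
  · rintro i τ ⟨hi, h1, h2⟩ hi'
    rw [(hI _ _ h1).stores.len] at hi'
    obtain rfl : i = D.length := by omega
    exact hQ τ h1

/-! ### Zeta and Möbius transforms -/

lemma BinOp.eval_sub (x y : ℕ) : BinOp.sub.eval x y = x - y := rfl

/-- For every vertex `v` in turn and every stored set `X` that contains `v`, combine the value of
`X` in array `a` with that of `X \ {v}`. -/
def transformProg (a : ℕ) (o : BinOp) : Prog :=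
  forVertex 4 3 (forList (.cond (bitExpr 5 3)
    (.put a (.reg 5) (.bin o (.get a (.reg 5)) (.get a (.bin .sub (.reg 5) (.reg 3))))) .skip))

/-- The family `F v` describes the contents after the vertices below `v`. The property `J` is
what the transform leaves alone. -/
lemma Runs.transform {o : BinOp} (hB : n + 1 < B) (hcl : ∀ X ∈ D, ∀ v ∈ X, X.erase v ∈ D)
    (F : ℕ → Finset ℕ → ℕ) (hF : ∀ v X, v ∈ X → F (v + 1) X = o.eval (F v X) (F v (X.erase v)))
    (hF' : ∀ v X, v ∉ X → F (v + 1) X = F v X) (hFB : ∀ v, ∀ X ⊆ range n, F v X < 2 ^ B)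
    (ha : a ≠ 0 ∧ a ≠ 1 ∧ a ≠ 2) (J : State → Prop)
    (hJ : ∀ τ r x, r = 3 ∨ r = 4 ∨ r = 5 ∨ r = 8 → J τ → J (τ.setReg r x))
    (hJ' : ∀ τ i x, J τ → J (τ.setArr a i x)) (hC : Ctx n s A B D σ)
    (h0 : Tabulates D a (F 0) σ) (hJ0 : J σ) (hl : n * (D.length * 5 + 5) + 3 ≤ l)
    (hQ : ∀ τ, Ctx n s A B D τ → Tabulates D a (F n) τ → J τ → Q τ) :
    Runs ω B (transformProg a o) σ l Q := by
  refine Runs.forVertex (k := D.length * 5 + 2)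
    (fun v τ => Ctx n s A B D τ ∧ Tabulates D a (F v) τ ∧ J τ) (by norm_num) (by omega)
    (fun i τ h => ⟨h.1.env.bdd, h.1.env.r0⟩) ?_ ⟨hC, h0, hJ0⟩ ?_ (by omega)
    (fun τ h => hQ τ h.1 h.2.1 h.2.2)
  · rintro v τ r x (rfl | rfl) hx ⟨h1, h2, h3⟩
    exacts [⟨h1.setReg (by norm_num) hx, h2, hJ _ _ _ (by norm_num) h3⟩,
      ⟨h1.setReg (by norm_num) hx, h2, hJ _ _ _ (by norm_num) h3⟩]
  · rintro v τ hv ⟨h1, h2, h3⟩ h4 h5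
    refine Runs.forEach (k := 2) hB (fun i υ => Ctx n s A B D υ ∧
      TabulatesUpto D a i (F (v + 1)) (F v) υ ∧ J υ ∧ υ.reg 4 = v ∧ υ.reg 3 = 2 ^ v)
      (fun i τ h => h.1) ?_ ⟨h1, h2.upto, h3, h4, h5⟩ ?_ (by omega) ?_
    · rintro v τ r x (rfl | rfl) hx ⟨h1, h2, h3, h4, h5⟩
      exacts [⟨h1.setReg (by norm_num) hx, h2, hJ _ _ _ (by norm_num) h3, by simp [h4],
        by simp [h5]⟩, ⟨h1.setReg (by norm_num) hx, h2, hJ _ _ _ (by norm_num) h3, by simp [h4],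
        by simp [h5]⟩]
    · rintro i υ hi ⟨g1, g2, g3, g4, g5⟩ g6
      have hmem : D[i] ∈ D := List.getElem_mem hi
      refine .cond (k := 1) g1.env.bdd (by simp [bitExpr_wt]) le_rfl ?_ ?_
      · intro h
        have hvX : v ∈ D[i] := by by_contra h'; simp [bitExpr_eval g6 g5, h'] at h
        have e1 : υ.arr a (code D[i]) = F v D[i] := by simpa using g2 i hi
        have e2 : υ.arr a (code (D[i].erase v)) = F v (D[i].erase v) := by
          obtain ⟨j, hj, hj'⟩ := List.getElem_of_mem (hcl _ hmem v hvX)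
          have := g2 j hj
          rw [hj'] at this
          rw [this, hF' v _ (by simp), ite_self]
        refine .put g1.env.bdd (by simp [Expr.wt]) le_rfl ?_
        simp only [Expr.eval, g6, g5, ← code_erase hvX, e1, BinOp.eval_sub, e2, ← hF v _ hvX]
        exact ⟨⟨g1.setArr ha (hFB _ _ (g1.stores.sub _ hmem)), g2.put g1.stores.nodup hi rfl,
          hJ' _ _ _ g3, g4, g5⟩, rfl⟩
      · intro h
        have hvX : v ∉ D[i] := by intro h'; simp [bitExpr_eval g6 g5, h'] at h
        exact .skip le_rfl ⟨⟨g1, g2.keep hi (hF' v _ hvX), g3, g4, g5⟩, rfl⟩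
    · rintro υ ⟨g1, g2, g3, g4, g5⟩
      exact ⟨⟨g1, g2.tabulates, g3⟩, g4, g5⟩

/-! ### Counting covers and reading off the answer -/

/-- Independence of the set in register `5` is recorded in register `12`. -/
def indProg : Prog :=
  .seq (.assign 12 (.const 1)) (forVertex 4 3 (forVertex 15 14
    (.cond (.bin .mul (.bin .mul (bitExpr 5 3) (bitExpr 5 14))
        (.get 0 (.bin .add (.bin .mul (.reg 0) (.reg 4)) (.reg 15))))
      (.assign 12 (.const 0)) .skip)))

/-- Array `3` receives the indicator of independence, array `4` ones, array `6` zeros. -/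
def initProg : Prog :=
  forList (.seq indProg (.seq (.put 3 (.reg 5) (.reg 12))
    (.seq (.put 4 (.reg 5) (.const 1)) (.put 6 (.reg 5) (.const 0)))))

/-- One round: arrays `3` and `4` hold the numbers of independent subsets and their `k`-th powers.
The Möbius transform of the latter, in array `5`, counts the covers by `k` independent sets. -/
def roundProg : Prog :=
  .seq (forList (.seq (.put 5 (.reg 5) (.get 4 (.reg 5)))
      (.put 4 (.reg 5) (.bin .mul (.get 4 (.reg 5)) (.get 3 (.reg 5))))))
    (.seq (transformProg 5 .sub)
      (forList (.put 6 (.reg 5) (.bin .add (.get 6 (.reg 5))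
        (.bin .eq (.get 5 (.reg 5)) (.const 0))))))

/-- Array `6` receives the chromatic numbers of the stored sets. -/
def chiProg : Prog :=
  .seq (.assign 10 (.const 0)) (.loop (.bin .lt (.reg 10) (.bin .add (.reg 0) (.const 1)))
    (.seq roundProg (incr 10)))

/-- The answer is YES if some stored set and its complement, also stored, have chromatic
numbers with sum at most `s`. -/
def answerProg : Prog :=
  .seq (.assign 12 (.const 0)) (.seq (forList
    (.cond (.bin .mul (.get 2 complExpr) (.bin .lt
        (.bin .add (.get 6 (.reg 5)) (.get 6 complExpr)) (.bin .add (.reg 1) (.const 1))))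
      (.assign 12 (.const 1)) .skip))
    (.assign 0 (.reg 12)))

end

section

open Finset

variable {ω : ℕ → Bool} {B : ℕ} {p q : Prog} {σ : State} {k l m : ℕ} {Q R : State → Prop}
variable {n s N : ℕ} {A : ℕ → ℕ → Prop} {D : List (Finset ℕ)} {S : Finset ℕ}

open Classical in
/-- A truth value as a number. -/
noncomputable def flag (P : Prop) : ℕ := if P then 1 else 0

lemma flag_of {P : Prop} (h : P) : flag P = 1 := if_pos h

lemma flag_not {P : Prop} (h : ¬ P) : flag P = 0 := if_neg h

lemma flag_ne_zero {P : Prop} : flag P ≠ 0 ↔ P := by unfold flag; split_ifs <;> simp_all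

lemma Runs.ind {X : Finset ℕ} (hB : n + 1 < B) (hC : Ctx n s A B D σ)
    (hX : σ.reg 5 = code X) (hXn : X ⊆ range n) (hk : n * (n * 5 + 6) + 4 ≤ k) :
    Runs ω B indProg σ k fun τ => Ctx n s A B D τ ∧ τ.arr = σ.arr ∧ τ.reg 5 = code X ∧
      τ.reg 8 = σ.reg 8 ∧ τ.reg 12 = ind A X := by
  have h1 : 1 < 2 ^ B := one_lt_two_pow (by omega)
  refine .assign_seq (k := n * (n * 5 + 6) + 3) hC.env.bdd (by simp [Expr.wt]) rfl (by omega) ?_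
  simp only [Expr.eval]
  -- No edge inside `X` leaves a vertex below `u`.
  let P : ℕ → Prop := fun u => ∀ u' < u, ∀ v' < n, u' ∈ X → v' ∈ X → ¬ A u' v'
  refine Runs.forVertex (k := n * 5 + 3) (fun u τ => Ctx n s A B D τ ∧ τ.arr = σ.arr ∧
    τ.reg 5 = code X ∧ τ.reg 8 = σ.reg 8 ∧ τ.reg 12 = flag (P u)) (by norm_num) (by omega)
    (fun i τ h => ⟨h.1.env.bdd, h.1.env.r0⟩) ?_ ?_ ?_ le_rfl ?_
  · rintro v τ r x (rfl | rfl) hx ⟨h1, h2, h3, h4, h5⟩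
    exacts [⟨h1.setReg (by norm_num) hx, h2, by simp [h3], by simp [h4], by simp [h5]⟩,
      ⟨h1.setReg (by norm_num) hx, h2, by simp [h3], by simp [h4], by simp [h5]⟩]
  · exact ⟨hC.setReg (by norm_num) h1, rfl, by simp [hX], by simp,
      by simp [flag_of (show P 0 from fun u' h => absurd h (Nat.not_lt_zero _))]⟩
  · rintro u τ hu ⟨h2, h3, h4, h5, h6⟩ h7 h8
    -- Nor does one lead from `u` to a vertex below `v`.
    let P' : ℕ → Prop := fun v => P u ∧ ∀ v' < v, u ∈ X → v' ∈ X → ¬ A u v'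
    refine Runs.forVertex (k := 2) (fun v τ => Ctx n s A B D τ ∧ τ.arr = σ.arr ∧
      τ.reg 5 = code X ∧ τ.reg 8 = σ.reg 8 ∧ τ.reg 12 = flag (P' v) ∧ τ.reg 4 = u ∧
      τ.reg 3 = 2 ^ u) (by norm_num) (by omega)
      (fun i τ h => ⟨h.1.env.bdd, h.1.env.r0⟩) ?_ ?_ ?_ (by omega) ?_
    · rintro v τ r x (rfl | rfl) hx ⟨h1, h2, h3, h4, h5, h6, h7⟩
      exacts [⟨h1.setReg (by norm_num) hx, h2, by simp [h3], by simp [h4], by simp [h5],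
        by simp [h6], by simp [h7]⟩, ⟨h1.setReg (by norm_num) hx, h2, by simp [h3], by simp [h4],
        by simp [h5], by simp [h6], by simp [h7]⟩]
    · refine ⟨h2, h3, h4, h5, ?_, h7, h8⟩
      rw [h6]
      congr 1
      simp [P']
    · rintro v τ hv ⟨g1, g2, g3, g4, g5, g6, g7⟩ g8 g9
      have hsucc : P' (v + 1) ↔ P' v ∧ ¬ (u ∈ X ∧ v ∈ X ∧ A u v) := by
        constructor
        · rintro ⟨h, h'⟩
          exact ⟨⟨h, fun v' hv' => h' v' (by omega)⟩, fun h'' =>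
            h' v (by omega) h''.1 h''.2.1 h''.2.2⟩
        · rintro ⟨⟨h, h'⟩, h''⟩
          refine ⟨h, fun v' hv' h1 h2 h3 => ?_⟩
          rcases (Nat.lt_succ_iff.1 hv').eq_or_lt with rfl | hv'
          exacts [h'' ⟨h1, h2, h3⟩, h' v' hv' h1 h2 h3]
      have heval : ((Expr.bin .mul (.bin .mul (bitExpr 5 3) (bitExpr 5 14))
          (.get 0 (.bin .add (.bin .mul (.reg 0) (.reg 4)) (.reg 15)))).eval τ) ≠ 0 ↔
          u ∈ X ∧ v ∈ X ∧ A u v := by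
        rw [← g1.env.adj u hu v hv]
        simp [Expr.eval, BinOp.eval, bitExpr_eval g3 g7, bitExpr_eval g3 g9, g1.env.r0, g6, g8]
        tauto
      refine .cond (k := 1) g1.env.bdd (by simp [Expr.wt, bitExpr_wt]) le_rfl ?_ ?_
      · intro h
        refine .assign g1.env.bdd (by simp [Expr.wt]) le_rfl ?_
        refine ⟨⟨g1.setReg (by norm_num) (by simp [Expr.eval]), g2, by simp [g3], by simp [g4], ?_,
          by simp [g6], by simp [g7]⟩, by simp [g8], by simp [g9]⟩
        rw [flag_not (by rw [hsucc]; exact fun h' => h'.2 (heval.1 h))]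
        simp [Expr.eval]
      · intro h
        refine .skip le_rfl ⟨⟨g1, g2, g3, g4, ?_, g6, g7⟩, g8, g9⟩
        rw [g5]
        congr 1
        have := fun h' => heval.2 h' h
        exact propext ⟨fun h' => hsucc.2 ⟨h', this⟩, fun h' => (hsucc.1 h').1⟩
    · rintro υ ⟨g1, g2, g3, g4, g5, g6, g7⟩
      refine ⟨⟨g1, g2, g3, g4, ?_⟩, g6, g7⟩
      rw [g5]
      congr 1
      refine propext ⟨?_, fun h => ⟨fun u' hu' => h u' (by omega), h u (by omega)⟩⟩
      rintro ⟨h, h'⟩ u' hu'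
      rcases (Nat.lt_succ_iff.1 hu').eq_or_lt with rfl | hu'
      exacts [h', h u' hu']
  · rintro τ ⟨h2, h3, h4, h5, h6⟩
    refine ⟨h2, h3, h4, h5, h6.trans ?_⟩
    rw [flag, RandRAM.ind]
    have : P n ↔ Ind A X := ⟨fun h u hu v hv => h u (mem_range.1 (hXn hu)) v
      (mem_range.1 (hXn hv)) hu hv, fun h u _ v _ hu hv => h u hu v hv⟩
    by_cases h : Ind A X
    · rw [if_pos h, if_pos (this.2 h)]
    · rw [if_neg h, if_neg fun h' => h (this.1 h')]

lemma ind_le_one (A : ℕ → ℕ → Prop) (X : Finset ℕ) : ind A X ≤ 1 := by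
  unfold ind; split_ifs <;> simp

lemma Runs.init (hB : n + 1 < B) (hC : Ctx n s A B D σ)
    (hk : D.length * (n * (n * 5 + 6) + 10) + 2 ≤ k) :
    Runs ω B initProg σ k fun τ => Ctx n s A B D τ ∧ Tabulates D 3 (RandRAM.ind A) τ ∧
      Tabulates D 4 (fun _ => 1) τ ∧ Tabulates D 6 (fun _ => 0) τ := by
  have h1 : 1 < 2 ^ B := one_lt_two_pow (by omega)
  refine Runs.forEach (k := n * (n * 5 + 6) + 7) hB (fun i τ => Ctx n s A B D τ ∧
    TabulatesUpto D 3 i (RandRAM.ind A) (fun X => σ.arr 3 (code X)) τ ∧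
    TabulatesUpto D 4 i (fun _ => 1) (fun X => σ.arr 4 (code X)) τ ∧
    TabulatesUpto D 6 i (fun _ => 0) (fun X => σ.arr 6 (code X)) τ) (fun i τ h => h.1) ?_ ?_ ?_
    (by omega) ?_
  · rintro v τ r x (rfl | rfl) hx ⟨h1, h2, h3, h4⟩
    exacts [⟨h1.setReg (by norm_num) hx, h2, h3, h4⟩, ⟨h1.setReg (by norm_num) hx, h2, h3, h4⟩]
  · exact ⟨hC, Tabulates.upto fun _ _ => rfl, Tabulates.upto fun _ _ => rfl,
      Tabulates.upto fun _ _ => rfl⟩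
  · rintro i τ hi ⟨h2, h3, h4, h5⟩ h6
    have hsub := h2.stores.sub _ (List.getElem_mem hi)
    refine Runs.seq (k := n * (n * 5 + 6) + 4) (l := 3) (Runs.ind hB h2 h6 hsub le_rfl) le_rfl ?_
    rintro υ ⟨g1, g2, g3, g4, g5⟩
    have g6 : TabulatesUpto D 3 i (RandRAM.ind A) (fun X => σ.arr 3 (code X)) υ := by
      unfold TabulatesUpto at *; rwa [g2]
    have g7 : TabulatesUpto D 4 i (fun _ => 1) (fun X => σ.arr 4 (code X)) υ := by
      unfold TabulatesUpto at *; rwa [g2]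
    have g8 : TabulatesUpto D 6 i (fun _ => 0) (fun X => σ.arr 6 (code X)) υ := by
      unfold TabulatesUpto at *; rwa [g2]
    have hn := g1.stores.nodup
    have c1 := g1.setArr (a := 3) (j := code D[i]) (x := RandRAM.ind A D[i]) (by norm_num)
      ((ind_le_one _ _).trans_lt h1)
    have c2 := c1.setArr (a := 4) (j := code D[i]) (x := 1) (by norm_num) h1
    have c3 := c2.setArr (a := 6) (j := code D[i]) (x := 0) (by norm_num) (by positivity)
    refine .put_seq (k := 2) g1.env.bdd (by simp [Expr.wt]) (x := code D[i])
      (by simp [Expr.eval, g3]) (y := RandRAM.ind A D[i]) (by simp [Expr.eval, g5]) le_rfl ?_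
    refine .put_seq (k := 1) c1.env.bdd (by simp [Expr.wt]) (x := code D[i])
      (by simp [Expr.eval, g3]) (y := 1) rfl le_rfl ?_
    refine .put c2.env.bdd (by simp [Expr.wt]) le_rfl ?_
    simp only [Expr.eval, reg_setArr, g3]
    refine ⟨⟨c3, ?_, ?_, ?_⟩, by simp [g4]⟩
    · exact ((g6.put hn hi rfl).setArr (by norm_num)).setArr (by norm_num)
    · exact ((g7.setArr (by norm_num)).put hn hi rfl).setArr (by norm_num)
    · exact ((g8.setArr (by norm_num)).setArr (by norm_num)).put hn hi rfl
  · rintro τ ⟨h2, h3, h4, h5⟩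
    exact ⟨h2, h3.tabulates, h4.tabulates, h5.tabulates⟩

/-- The number of independent subsets. -/
noncomputable def indCount (A : ℕ → ℕ → Prop) (X : Finset ℕ) : ℕ := ∑ Y ∈ X.powerset, ind A Y

/-- The number of `l < k` for which `X` has no cover by `l` independent sets. -/
noncomputable def chiUpto (A : ℕ → ℕ → Prop) (k : ℕ) (X : Finset ℕ) : ℕ :=
  #{l ∈ range k | covers A l X = 0}

lemma chiUpto_le (A : ℕ → ℕ → Prop) (k : ℕ) (X : Finset ℕ) : chiUpto A k X ≤ k :=
  (card_filter_le _ _).trans (by simp)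

lemma chiUpto_succ (A : ℕ → ℕ → Prop) (k : ℕ) (X : Finset ℕ) :
    chiUpto A (k + 1) X = chiUpto A k X + if covers A k X = 0 then 1 else 0 := by
  unfold chiUpto
  rw [range_add_one, filter_insert]
  split_ifs with h
  · rw [card_insert_of_notMem (by simp)]
  · rfl

lemma indCount_pow_lt {X : Finset ℕ} (hB : n * (n + 1) < B) (hk : k ≤ n + 1) (hX : X ⊆ range n) :
    indCount A X ^ k < 2 ^ B := by
  calc indCount A X ^ k ≤ (2 ^ n) ^ k := Nat.pow_le_pow_left (sum_powerset_ind_le hX) k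
    _ ≤ (2 ^ n) ^ (n + 1) := Nat.pow_le_pow_right (by positivity) hk
    _ = 2 ^ (n * (n + 1)) := by rw [pow_mul]
    _ < 2 ^ B := Nat.pow_lt_pow_right (by norm_num) hB

/-- The state between two rounds. -/
structure AfterRounds (n s : ℕ) (A : ℕ → ℕ → Prop) (B : ℕ) (D : List (Finset ℕ)) (k : ℕ)
    (σ : State) : Prop where
  ctx : Ctx n s A B D σ
  count : Tabulates D 3 (indCount A) σ
  power : Tabulates D 4 (fun X => indCount A X ^ k) σ
  chi : Tabulates D 6 (chiUpto A k) σ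

lemma Runs.round (hB : n * (n + 1) + 2 < B) (hcl : ∀ X ∈ D, ∀ v ∈ X, X.erase v ∈ D)
    (h : AfterRounds n s A B D k σ) (hr : σ.reg 10 = k) (hk : k ≤ n)
    (hl : D.length * 9 + n * (D.length * 5 + 5) + 7 ≤ l) :
    Runs ω B roundProg σ l fun τ => AfterRounds n s A B D (k + 1) τ ∧ τ.reg 10 = k := by
  have hB1 : n + 1 < B := by nlinarith
  have hB2 : n * (n + 1) < B := by omega
  have hpow : 2 ^ n < 2 ^ B := Nat.pow_lt_pow_right (by norm_num) (by omega)
  refine Runs.seq (k := D.length * 5 + 2) (l := D.length * 4 + n * (D.length * 5 + 5) + 5)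
    (R := fun τ => Ctx n s A B D τ ∧ Tabulates D 3 (indCount A) τ ∧
      Tabulates D 4 (fun X => indCount A X ^ (k + 1)) τ ∧
      Tabulates D 5 (fun X => indCount A X ^ k) τ ∧ Tabulates D 6 (chiUpto A k) τ ∧
      τ.reg 10 = k) ?_ (by omega) ?_
  · refine Runs.forEach (k := 2) hB1 (fun i τ => Ctx n s A B D τ ∧ Tabulates D 3 (indCount A) τ ∧
      TabulatesUpto D 4 i (fun X => indCount A X ^ (k + 1)) (fun X => indCount A X ^ k) τ ∧
      TabulatesUpto D 5 i (fun X => indCount A X ^ k) (fun X => σ.arr 5 (code X)) τ ∧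
      Tabulates D 6 (chiUpto A k) τ ∧ τ.reg 10 = k) (fun i τ h => h.1) ?_
      ⟨h.ctx, h.count, h.power.upto, Tabulates.upto fun _ _ => rfl, h.chi, hr⟩ ?_ (by omega) ?_
    · rintro v τ r x (rfl | rfl) hx ⟨h1, h2, h3, h4, h5, h6⟩
      exacts [⟨h1.setReg (by norm_num) hx, h2, h3, h4, h5, by simp [h6]⟩,
        ⟨h1.setReg (by norm_num) hx, h2, h3, h4, h5, by simp [h6]⟩]
    · rintro i τ hi ⟨h1, h2, h3, h4, h5, h6⟩ h7
      have hmem : D[i] ∈ D := List.getElem_mem hi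
      have hsub := h1.stores.sub _ hmem
      have hn := h1.stores.nodup
      have e3 : τ.arr 3 (code D[i]) = indCount A D[i] := h2 _ hmem
      have e4 : τ.arr 4 (code D[i]) = indCount A D[i] ^ k := by simpa using h3 i hi
      have c1 := h1.setArr (a := 5) (j := code D[i]) (by norm_num)
        (indCount_pow_lt (k := k) (A := A) hB2 (by omega) hsub)
      have c2 := c1.setArr (a := 4) (j := code D[i]) (by norm_num)
        (indCount_pow_lt (k := k + 1) (A := A) hB2 (by omega) hsub)
      refine .put_seq (k := 1) h1.env.bdd (by simp [Expr.wt]) (x := code D[i])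
        (by simp [Expr.eval, h7]) (y := indCount A D[i] ^ k) (by simp [Expr.eval, h7, e4]) le_rfl ?_
      refine .put c1.env.bdd (by simp [Expr.wt]) le_rfl ?_
      have e5 : (Expr.bin .mul (.get 4 (.reg 5)) (.get 3 (.reg 5))).eval
          (τ.setArr 5 (code D[i]) (indCount A D[i] ^ k)) = indCount A D[i] ^ (k + 1) := by
        simp [Expr.eval, BinOp.eval, h7, e3, e4, pow_succ]
      rw [e5]
      simp only [Expr.eval, reg_setArr, h7]
      exact ⟨⟨c2, (h2.setArr (by norm_num)).setArr (by norm_num),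
        (h3.setArr (by norm_num)).put hn hi rfl, (h4.put hn hi rfl).setArr (by norm_num),
        (h5.setArr (by norm_num)).setArr (by norm_num), h6⟩, trivial⟩
    · rintro τ ⟨h1, h2, h3, h4, h5, h6⟩
      exact ⟨h1, h2, h3.tabulates, h4.tabulates, h5, h6⟩
  rintro τ ⟨h1, h2, h3, h4, h5, h6⟩
  refine Runs.seq (k := n * (D.length * 5 + 5) + 3) (l := D.length * 4 + 2)
    (R := fun τ => Ctx n s A B D τ ∧ Tabulates D 3 (indCount A) τ ∧
      Tabulates D 4 (fun X => indCount A X ^ (k + 1)) τ ∧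
      Tabulates D 5 (covers A k) τ ∧ Tabulates D 6 (chiUpto A k) τ ∧
      τ.reg 10 = k) ?_ (by omega) ?_
  · refine Runs.transform hB1 hcl (moebUpto (covers A k)) (fun v X hv => moebUpto_succ_of_mem hv)
      (fun v X hv => moebUpto_succ_of_notMem hv) (fun v X hX => ?_) (by norm_num)
      (fun τ => Tabulates D 3 (indCount A) τ ∧ Tabulates D 4 (fun X => indCount A X ^ (k + 1)) τ ∧
        Tabulates D 6 (chiUpto A k) τ ∧ τ.reg 10 = k) ?_ ?_ h1 ?_ ⟨h2, h3, h5, h6⟩ le_rfl ?_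
    · calc moebUpto (covers A k) v X ≤ (2 ^ n) ^ k := moebUpto_covers_le hX
        _ ≤ (2 ^ n) ^ (n + 1) := Nat.pow_le_pow_right (by positivity) (by omega)
        _ = 2 ^ (n * (n + 1)) := by rw [pow_mul]
        _ < 2 ^ B := Nat.pow_lt_pow_right (by norm_num) hB2
    · rintro τ r x hr ⟨h1, h2, h3, h4⟩
      have : 10 ≠ r := by omega
      exact ⟨h1, h2, h3, by simp [this, h4]⟩
    · rintro τ i x ⟨h1, h2, h3, h4⟩
      exact ⟨h1.setArr (by norm_num), h2.setArr (by norm_num), h3.setArr (by norm_num), h4⟩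
    · intro X hX
      rw [moebUpto_zero, sum_powerset_covers]
      exact h4 X hX
    · rintro τ g1 g2 ⟨g3, g4, g5, g6⟩
      refine ⟨g1, g3, g4, fun X hX => ?_, g5, g6⟩
      rw [g2 X hX, moebUpto_of_subset_range (g1.stores.sub X hX)]
  rintro τ ⟨h1, h2, h3, h4, h5, h6⟩
  refine Runs.forEach (k := 1) hB1 (fun i τ => Ctx n s A B D τ ∧ Tabulates D 3 (indCount A) τ ∧
      Tabulates D 4 (fun X => indCount A X ^ (k + 1)) τ ∧
      Tabulates D 5 (covers A k) τ ∧ TabulatesUpto D 6 i (chiUpto A (k + 1)) (chiUpto A k) τ ∧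
      τ.reg 10 = k) (fun i τ h => h.1) ?_ ⟨h1, h2, h3, h4, h5.upto, h6⟩ ?_ le_rfl ?_
  · rintro v τ r x (rfl | rfl) hx ⟨h1, h2, h3, h4, h5, h6⟩
    exacts [⟨h1.setReg (by norm_num) hx, h2, h3, h4, h5, by simp [h6]⟩,
      ⟨h1.setReg (by norm_num) hx, h2, h3, h4, h5, by simp [h6]⟩]
  · rintro i τ hi ⟨h1, h2, h3, h4, h5, h6⟩ h7
    have hmem : D[i] ∈ D := List.getElem_mem hi
    have e5 : τ.arr 5 (code D[i]) = covers A k D[i] := h4 _ hmem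
    have e6 : τ.arr 6 (code D[i]) = chiUpto A k D[i] := by simpa using h5 i hi
    refine .put h1.env.bdd (by simp [Expr.wt]) le_rfl ?_
    simp only [Expr.eval, BinOp.eval, h7, e5, e6, ← chiUpto_succ]
    have hlt : chiUpto A (k + 1) D[i] < 2 ^ B := by
      have := chiUpto_le A (k + 1) D[i]
      have : n < 2 ^ n := Nat.lt_two_pow_self
      omega
    exact ⟨⟨h1.setArr (by norm_num) hlt, h2.setArr (by norm_num), h3.setArr (by norm_num),
      h4.setArr (by norm_num), h5.put h1.stores.nodup hi rfl, h6⟩, rfl⟩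
  · rintro τ ⟨h1, h2, h3, h4, h5, h6⟩
    exact ⟨⟨h1, h2, h3, h5.tabulates⟩, h6⟩

lemma Runs.chi (hB : n * (n + 1) + 2 < B) (hcl : ∀ X ∈ D, ∀ v ∈ X, X.erase v ∈ D)
    (h : AfterRounds n s A B D 0 σ)
    (hl : (n + 1) * (D.length * 9 + n * (D.length * 5 + 5) + 9) + 2 ≤ l) :
    Runs ω B chiProg σ l fun τ => AfterRounds n s A B D (n + 1) τ := by
  have hB1 : n + 1 < B := by nlinarith
  have hpow : 2 ^ n < 2 ^ B := Nat.pow_lt_pow_right (by norm_num) (by omega)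
  have hn : n < 2 ^ n := Nat.lt_two_pow_self
  have hreg : ∀ {k k' τ}, k' < 2 ^ B → AfterRounds n s A B D k τ →
      AfterRounds n s A B D k (τ.setReg 10 k') := fun hk' h =>
    ⟨h.ctx.setReg (by norm_num) hk', h.count, h.power, h.chi⟩
  refine .assign_seq (k := (n + 1) * (D.length * 9 + n * (D.length * 5 + 5) + 9) + 1)
    h.ctx.env.bdd (by simp [Expr.wt]) rfl (by omega) ?_
  refine Runs.loop (k := D.length * 9 + n * (D.length * 5 + 5) + 8) (m := n + 1)
    (fun k τ => k ≤ n + 1 ∧ AfterRounds n s A B D k τ ∧ τ.reg 10 = k) (by simp [Expr.wt])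
    (fun i τ h => h.2.1.ctx.env.bdd) ?_
    ⟨Nat.zero_le _, hreg (by positivity) h, by simp [Expr.eval]⟩ le_rfl ?_
  · rintro i τ ⟨hi, h1, h2⟩ h3
    have hi' : i < n + 1 := by
      by_contra h4
      simp [Expr.eval, BinOp.eval, h2, h1.ctx.env.r0, h4] at h3
    refine ⟨hi', Runs.seq (k := D.length * 9 + n * (D.length * 5 + 5) + 7) (l := 1)
      (Runs.round hB hcl h1 h2 (by omega) le_rfl) le_rfl ?_⟩
    rintro υ ⟨h4, h5⟩
    refine .assign h4.ctx.env.bdd (by simp [Expr.wt]) le_rfl ?_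
    simp only [Expr.eval, BinOp.eval, h5]
    exact ⟨hi', hreg (by omega) h4, by simp⟩
  · rintro i τ ⟨hi, h1, h2⟩ h3
    have hi' : i = n + 1 := by
      by_contra h4
      simp [Expr.eval, BinOp.eval, h2, h1.ctx.env.r0, show i < n + 1 by omega] at h3
    exact hi' ▸ h1

lemma Runs.answer (hB : n + 1 < B) (hC : Ctx n s A B D σ) (h6 : Tabulates D 6 (RandRAM.chi A n) σ)
    (hl : D.length * 5 + 4 ≤ l) :
    Runs ω B answerProg σ l fun τ => τ.reg 0 ≠ 0 ↔ ∃ X ∈ D, range n \ X ∈ D ∧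
      RandRAM.chi A n X + RandRAM.chi A n (range n \ X) ≤ s := by
  have h1 : 1 < 2 ^ B := one_lt_two_pow (by omega)
  let P : ℕ → Prop := fun i => ∃ j, j < i ∧ ∃ h : j < D.length, range n \ D[j] ∈ D ∧
      RandRAM.chi A n D[j] + RandRAM.chi A n (range n \ D[j]) ≤ s
  refine .assign_seq (k := D.length * 5 + 3) hC.env.bdd (by simp [Expr.wt]) rfl (by omega) ?_
  refine Runs.seq (k := D.length * 5 + 2) (l := 1)
    (R := fun τ => τ.Bdd B ∧ τ.reg 12 = flag (P D.length)) ?_ le_rfl ?_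
  · refine Runs.forEach (k := 2) hB (fun i τ => Ctx n s A B D τ ∧
      Tabulates D 6 (RandRAM.chi A n) τ ∧ τ.reg 12 = flag (P i)) (fun i τ h => h.1) ?_
      ⟨hC.setReg (by norm_num) (by positivity), h6, ?_⟩ ?_ le_rfl fun τ h => ⟨h.1.env.bdd, h.2.2⟩
    · rintro v τ r x (rfl | rfl) hx ⟨h1, h2, h3⟩
      exacts [⟨h1.setReg (by norm_num) hx, h2, by simp [h3]⟩,
        ⟨h1.setReg (by norm_num) hx, h2, by simp [h3]⟩]
    · rw [flag_not (by simp [P])]; simp [Expr.eval]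
    · rintro i τ hi ⟨g1, g2, g3⟩ g4
      have hmem : D[i] ∈ D := List.getElem_mem hi
      have hsub := g1.stores.sub _ hmem
      have hc := complExpr_eval g1.env.r9 g4 hsub
      have hsucc : P (i + 1) ↔ P i ∨ (range n \ D[i] ∈ D ∧
          RandRAM.chi A n D[i] + RandRAM.chi A n (range n \ D[i]) ≤ s) := by
        constructor
        · rintro ⟨j, hj, hj', h⟩
          rcases (Nat.lt_succ_iff.1 hj).eq_or_lt with rfl | hj
          exacts [.inr h, .inl ⟨j, hj, hj', h⟩]
        · rintro (⟨j, hj, h⟩ | h)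
          exacts [⟨j, by omega, h⟩, ⟨i, by omega, hi, h⟩]
      have heval : (Expr.bin .mul (.get 2 complExpr) (.bin .lt
          (.bin .add (.get 6 (.reg 5)) (.get 6 complExpr)) (.bin .add (.reg 1) (.const 1)))).eval τ
          ≠ 0 ↔ range n \ D[i] ∈ D ∧
          RandRAM.chi A n D[i] + RandRAM.chi A n (range n \ D[i]) ≤ s := by
        have hmark := g1.stores.mark (range n \ D[i]) sdiff_subset
        by_cases hD' : range n \ D[i] ∈ D
        · simp [Expr.eval, BinOp.eval, hc, g4, g2 _ hmem, hmark, hD', g1.env.r1, g2 _ hD']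
        · simp [Expr.eval, BinOp.eval, hc, hmark, hD']
      refine .cond (k := 1) g1.env.bdd (by simp [Expr.wt, complExpr]) le_rfl ?_ ?_
      · intro h
        refine .assign g1.env.bdd (by simp [Expr.wt]) le_rfl ?_
        simp only [Expr.eval]
        refine ⟨⟨g1.setReg (by norm_num) h1, g2, ?_⟩, by simp⟩
        rw [flag_of (hsucc.2 (.inr (heval.1 h)))]
        simp
      · intro h
        have h' := fun h' => heval.2 h' h
        refine .skip le_rfl ⟨⟨g1, g2, ?_⟩, rfl⟩
        rw [g3]
        congr 1
        exact propext ⟨fun h => hsucc.2 (.inl h), fun h => (hsucc.1 h).resolve_right h'⟩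
  · rintro τ ⟨h2, h3⟩
    refine .assign h2 (by simp [Expr.wt]) le_rfl ?_
    simp only [Expr.eval, reg_setReg, if_true, h3, flag_ne_zero]
    constructor
    · rintro ⟨j, hj, hj', h⟩
      exact ⟨D[j], List.getElem_mem hj, h⟩
    · rintro ⟨X, hX, h⟩
      obtain ⟨j, hj, rfl⟩ := List.getElem_of_mem hX
      exact ⟨j, hj, hj, h⟩

end

section

open Finset

variable {ω : ℕ → Bool} {B : ℕ} {p q : Prog} {σ : State} {k l m : ℕ} {Q R : State → Prop}
variable {n s N : ℕ} {A : ℕ → ℕ → Prop} {D : List (Finset ℕ)} {S : Finset ℕ}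

/-! ### The algorithm -/

/-- The adjacency relation of a graph on `Fin n`, as a relation on natural numbers. -/
def natAdj (G : SimpleGraph (Fin n)) (u v : ℕ) : Prop :=
  ∃ i j : Fin n, G.Adj i j ∧ (i : ℕ) = u ∧ (j : ℕ) = v

/-- The logarithm of the number of samples, `n - (s - 1) / 2`. -/
def logSamples : Expr :=
  .bin .sub (.reg 0) (.bin .div (.bin .sub (.reg 1) (.const 1)) (.const 2))

/-- Sample sets of `n / 2` vertices, close them and their complements under taking subsets, compute
the chromatic numbers of all sets obtained, and look for a set and a complement that can be
coloured with `s` colours in total. If `s > n`, the answer is YES. -/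
def algorithm : Prog :=
  .cond (.bin .lt (.reg 0) (.reg 1)) (.assign 0 (.const 1))
    (.seq (powTwo 9 (.reg 0)) (.seq (powTwo 2 logSamples) (.seq sampleProg (.seq closureProg
      (.seq initProg (.seq (transformProg 3 .add) (.seq chiProg answerProg)))))))

/-- The family of all subsets of the sampled halves and of their complements. -/
noncomputable def family (ω : ℕ → Bool) (n N : ℕ) : Finset (Finset ℕ) :=
  open Classical in {X ∈ (range n).powerset | ∃ Y, IsHalf ω n N Y ∧ X ⊆ Y}

lemma mem_family {X : Finset ℕ} : X ∈ family ω n N ↔ ∃ Y, IsHalf ω n N Y ∧ X ⊆ Y := by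
  simp only [family, mem_filter, mem_powerset, and_iff_right_iff_imp]
  rintro ⟨Y, hY, hXY⟩
  exact hXY.trans hY.subset

lemma natAdj_irrefl (G : SimpleGraph (Fin n)) (v : ℕ) : ¬ natAdj G v v := by
  rintro ⟨i, j, h, rfl, h'⟩
  exact h.ne (Fin.ext h'.symm)

lemma initState_bdd (G : SimpleGraph (Fin n)) (hB : 1 ≤ B) (hn : n < 2 ^ B) (hs : s < 2 ^ B) :
    (initState n G s).Bdd B := by
  have h1 := one_lt_two_pow hB
  refine ⟨fun r => ?_, fun a i => ?_⟩
  · simp only [initState]; split_ifs <;> omega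
  · simp only [initState]; split_ifs <;> omega

lemma initState_adj (G : SimpleGraph (Fin n)) {u v : ℕ} (hu : u < n) (hv : v < n) :
    (initState n G s).arr 0 (n * u + v) ≠ 0 ↔ natAdj G u v := by
  simp only [initState, true_and, ne_eq, ite_eq_right_iff, one_ne_zero, imp_false, not_not]
  constructor
  · rintro ⟨i, j, h, hij⟩
    have h1 : u = i := by
      have := congrArg (· / n) hij
      simpa [Nat.mul_add_div (show 0 < n by omega), Nat.div_eq_of_lt hv,
        Nat.div_eq_of_lt j.2] using this
    subst h1
    exact ⟨i, j, h, rfl, by omega⟩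
  · rintro ⟨i, j, h, rfl, rfl⟩
    exact ⟨i, j, h, rfl⟩

lemma runs_algorithm (G : SimpleGraph (Fin n)) (hs : s ≤ n) (hB : n * (n + 1) + 2 < B)
    (hN : 2 ^ (n - (s - 1) / 2) = N) :
    Runs ω B algorithm (initState n G s) (200 * (n + 1) ^ 2 * (N + #(family ω n N)))
      fun τ => τ.reg 0 ≠ 0 ↔ ∃ X ∈ family ω n N, range n \ X ∈ family ω n N ∧
        chi (natAdj G) n X + chi (natAdj G) n (range n \ X) ≤ s := by
  set m := #(family ω n N) with hm
  have hB1 : n + 1 < B := by nlinarith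
  have hn : n < 2 ^ n := Nat.lt_two_pow_self
  have hpow : 2 ^ n < 2 ^ B := Nat.pow_lt_pow_right (by norm_num) (by omega)
  have hN1 : 1 ≤ N := hN ▸ Nat.one_le_two_pow
  have hNB : N < 2 ^ B := by
    rw [← hN]; exact Nat.pow_lt_pow_right (by norm_num) (by omega)
  have hb0 := initState_bdd (s := s) G (by omega) (by omega) (show s < 2 ^ B by omega)
  set σ₀ := initState n G s with hσ₀
  have hr0 : σ₀.reg 0 = n := by simp [hσ₀, initState]
  have hr1 : σ₀.reg 1 = s := by simp [hσ₀, initState]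
  obtain ⟨k₁, hk₁⟩ : ∃ k, k = n * 3 + 3 := ⟨_, rfl⟩
  obtain ⟨k₂, hk₂⟩ : ∃ k, k = N * (n * 7 + 16) + 1 := ⟨_, rfl⟩
  obtain ⟨k₃, hk₃⟩ : ∃ k, k = m * (n * 8 + 6) + 2 := ⟨_, rfl⟩
  obtain ⟨k₄, hk₄⟩ : ∃ k, k = m * (n * (n * 5 + 6) + 10) + 2 := ⟨_, rfl⟩
  obtain ⟨k₅, hk₅⟩ : ∃ k, k = n * (m * 5 + 5) + 3 := ⟨_, rfl⟩
  obtain ⟨k₆, hk₆⟩ : ∃ k, k = (n + 1) * (m * 9 + n * (m * 5 + 5) + 9) + 2 := ⟨_, rfl⟩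
  obtain ⟨k₇, hk₇⟩ : ∃ k, k = m * 5 + 4 := ⟨_, rfl⟩
  have key : Runs ω B algorithm σ₀ (k₁ + (k₁ + (k₂ + (k₃ + (k₄ + (k₅ + (k₆ + k₇)))))) + 1)
      fun τ => τ.reg 0 ≠ 0 ↔ ∃ X ∈ family ω n N, range n \ X ∈ family ω n N ∧
        chi (natAdj G) n X + chi (natAdj G) n (range n \ X) ≤ s := by
    refine .cond hb0 (by simp [Expr.wt]) le_rfl (fun h => ?_) fun _ => ?_
    · simp [Expr.eval, BinOp.eval, hr0, hr1, not_lt.2 hs] at h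
    refine Runs.seq (R := fun τ => Env n s (natAdj G) B τ ∧ Stores n [] τ ∧ τ.used = 0)
      (.powTwo (E := n) (by norm_num) hb0 (by omega) (by simp [Expr.eval, hr0]) (by simp [Expr.wt])
        hk₁.ge ?_) le_rfl ?_
    · intro y hy
      refine ⟨⟨(hb0.setReg hpow).setReg hy, by simp [hr0], by simp [hr1], by simp,
        fun u hu v hv => initState_adj (s := s) G hu hv⟩,
        ⟨?_, ?_, ?_, List.nodup_nil, by simp⟩, rfl⟩
      · simp [hσ₀, initState]
      · simp
      · intro S _; simp [hσ₀, initState]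
    rintro τ ⟨h1, h2, h3⟩
    refine Runs.seq (R := fun τ => Env n s (natAdj G) B τ ∧ Stores n [] τ ∧ τ.used = 0 ∧
      τ.reg 2 = N)
      (.powTwo (E := n - (s - 1) / 2) (l := k₁) (by norm_num) h1.bdd (by omega)
        (by simp [logSamples, Expr.eval, BinOp.eval, h1.r0, h1.r1])
        (by simp [logSamples, Expr.wt]; decide) (by omega) ?_) le_rfl ?_
    · intro y hy
      exact ⟨(h1.setReg (by norm_num) (by rwa [hN])).setReg (by norm_num) hy,
        (h2.setReg (by norm_num)).setReg (by norm_num), h3, by simp [hN]⟩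
    rintro τ ⟨h1, h2, h3, h4⟩
    refine Runs.seq (Runs.sample hB1 h1 h2 h3 h4 hk₂.ge) le_rfl ?_
    rintro τ ⟨h1, D, h2, h3⟩
    refine Runs.seq (Runs.closure hB1 h1 h2 h3 (family ω n N) (fun X => mem_family) rfl
      hk₃.ge) le_rfl ?_
    rintro τ ⟨h1, D, h2, h3, h4⟩
    have hcl : ∀ X ∈ D, ∀ v ∈ X, X.erase v ∈ D := by
      intro X hX v _
      obtain ⟨Y, hY, hXY⟩ := mem_family.1 ((h4 X).1 hX)
      exact (h4 _).2 (mem_family.2 ⟨Y, hY, (erase_subset _ _).trans hXY⟩)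
    have hC : Ctx n s (natAdj G) B D τ := ⟨h1, h2⟩
    rw [← hm] at h3
    rw [← h3] at hk₄ hk₅ hk₆ hk₇
    refine Runs.seq (Runs.init hB1 hC hk₄.ge) le_rfl ?_
    rintro τ ⟨h5, h6, h7, h8⟩
    refine Runs.seq (R := AfterRounds n s (natAdj G) B D 0) (Runs.transform hB1 hcl
      (zetaUpto (ind (natAdj G))) (fun v X hv => zetaUpto_succ_of_mem hv)
      (fun v X hv => zetaUpto_succ_of_notMem hv)
      (fun v X hX => (zetaUpto_ind_le hX).trans_lt hpow) (by norm_num)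
      (fun τ => Tabulates D 4 (fun _ => 1) τ ∧ Tabulates D 6 (fun _ => 0) τ)
      (fun τ r x _ h => h) (fun τ i x h => ⟨h.1.setArr (by norm_num), h.2.setArr (by norm_num)⟩)
      h5 (fun X hX => by rw [zetaUpto_zero]; exact h6 X hX) ⟨h7, h8⟩ hk₅.ge ?_) le_rfl ?_
    · rintro τ g1 g2 ⟨g3, g4⟩
      refine ⟨g1, fun X hX => ?_, fun X hX => by simpa using g3 X hX, fun X hX => ?_⟩
      · rw [g2 X hX, zetaUpto_of_subset_range (g1.stores.sub X hX), indCount]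
      · rw [g4 X hX]; simp [chiUpto]
    intro τ h9
    refine Runs.seq (Runs.chi hB hcl h9 hk₆.ge) le_rfl ?_
    intro τ h10
    refine (Runs.answer hB1 h10.ctx h10.chi hk₇.ge).mono le_rfl ?_
    intro τ h11
    rw [h11]
    simp only [h4]
  refine key.mono ?_ fun _ => id
  have e1 : 1 ≤ N + m := by omega
  have : k₁ + (k₁ + (k₂ + (k₃ + (k₄ + (k₅ + (k₆ + k₇)))))) + 1 ≤
      (n + 1) ^ 2 * (100 * (N + m) + 100 * 1) := by
    subst hk₁ hk₂ hk₃ hk₄ hk₅ hk₆ hk₇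
    ring_nf
    nlinarith [Nat.zero_le (n * N), Nat.zero_le (n ^ 2 * N), Nat.zero_le (n * m),
      Nat.zero_le (n ^ 2 * m), Nat.zero_le (n ^ 2)]
  nlinarith [Nat.mul_le_mul_left ((n + 1) ^ 2) (show 100 * 1 ≤ 100 * (N + m) by omega)]

end

section

open Finset

/-! ### The probability of hitting a large family -/

section Probability

open MeasureTheory Measure ProbabilityTheory

/-- A fair coin. -/
noncomputable abbrev coin : Measure Bool := (PMF.uniformOfFintype Bool).toMeasure

/-- The law of a string of `n` fair bits. -/
noncomputable abbrev coins (n : ℕ) : Measure (Fin n → Bool) := infinitePi fun _ => coin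

/-- The subset of `{0, …, n - 1}` with the given indicator. -/
def ofBits {n : ℕ} (x : Fin n → Bool) : Finset ℕ := {v ∈ range n | ∃ h : v < n, x ⟨v, h⟩ = true}

lemma sample_eq_ofBits (ω : ℕ → Bool) (n j : ℕ) :
    sample ω n j = ofBits fun v : Fin n => ω (j * n + v) := by
  ext v
  simp only [sample, ofBits, mem_filter, mem_range]
  exact and_congr_right fun h => by simp [h]

lemma coins_singleton {n : ℕ} (x : Fin n → Bool) : (coins n).real {x} = (1 / 2) ^ n := by
  rw [measureReal_def, infinitePi_singleton_of_fintype]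
  have : ∀ b : Bool, coin {b} = 2⁻¹ := fun b => by
    rw [PMF.toMeasure_apply_singleton _ _ (measurableSet_singleton b)]
    simp
  simp [this]

lemma card_le_coins {n : ℕ} (W : Finset (Finset ℕ)) (hW : ∀ S ∈ W, S ⊆ range n) :
    (#W : ℝ) / 2 ^ n ≤ (coins n).real {x | ofBits x ∈ W} := by
  classical
  let g : Finset ℕ → Fin n → Bool := fun S v => decide ((v : ℕ) ∈ S)
  have hg : ∀ S ∈ W, ofBits (g S) = S := by
    intro S hS
    ext v
    simp only [ofBits, g, mem_filter, mem_range, decide_eq_true_eq, exists_prop, and_self_left]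
    exact and_iff_right_of_imp fun h => mem_range.1 (hW S hS h)
  have hinj : Set.InjOn g W := fun S hS T hT h => by rw [← hg S hS, ← hg T hT, h]
  calc (#W : ℝ) / 2 ^ n = ∑ x ∈ W.image g, (coins n).real {x} := by
        simp only [coins_singleton, sum_const, card_image_of_injOn hinj, nsmul_eq_mul]
        rw [one_div, inv_pow, div_eq_mul_inv]
    _ = (coins n).real (W.image g : Finset _) := by
        rw [sum_measureReal_singleton]
    _ ≤ _ := by
        refine measureReal_mono ?_
        intro x hx
        obtain ⟨S, hS, rfl⟩ := mem_image.1 (mem_coe.1 hx)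
        simpa [hg S hS] using hS

/-- Cutting the tape into blocks of `n` bits gives independent uniform strings. -/
lemma fairCoins_map_blocks (n : ℕ) :
    fairCoins.map (fun ω (j : ℕ) (v : Fin n) => ω (j * n + v)) = infinitePi fun _ => coins n := by
  have hinj : Function.Injective fun p : ℕ × Fin n => p.1 * n + (p.2 : ℕ) := by
    rintro ⟨j, v⟩ ⟨j', v'⟩ h
    have hn : 0 < n := v.pos
    simp only at h
    have h1 : j = j' := by
      have := congrArg (· / n) h
      simpa [Nat.add_div_of_dvd_right, Nat.mul_div_cancel _ hn, Nat.div_eq_of_lt v.2,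
        Nat.div_eq_of_lt v'.2] using this
    subst h1
    simp only [Prod.mk.injEq, true_and]
    exact Fin.ext (by omega)
  have h1 := map_infinitePi_infinitePi_of_inj (P := fun _ : ℕ => coin) hinj
  have h2 := infinitePi_map_curry (fun (_ : ℕ) (_ : Fin n) => coin)
  rw [← h1, Measure.map_map (by fun_prop) (by fun_prop)] at h2
  exact h2

/-- If `N` is at least the reciprocal of the density of `W`, then one of `N` samples hits `W` with
probability at least `1 - 1 / e ≥ 1 / 2`. -/
lemma half_le_fairCoins {n N : ℕ} (W : Finset (Finset ℕ)) (hW : ∀ S ∈ W, S ⊆ range n)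
    (hcard : 2 ^ n ≤ #W * N) :
    ENNReal.ofReal (1 / 2) ≤ fairCoins {ω | ∃ j < N, sample ω n j ∈ W} := by
  have : IsProbabilityMeasure fairCoins := by unfold fairCoins; infer_instance
  set K : Set (Fin n → Bool) := {x | ofBits x ∈ W} with hK
  have hKm : MeasurableSet K := (Set.toFinite K).measurableSet
  have hblocks : Measurable fun (ω : ℕ → Bool) (j : ℕ) (v : Fin n) => ω (j * n + v) := by fun_prop
  have hpim : MeasurableSet (Set.pi (range N : Set ℕ) fun _ => Kᶜ) :=
    .pi (range N).countable_toSet fun _ _ => hKm.compl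
  have hset : {ω | ∃ j < N, sample ω n j ∈ W} =
      ((fun (ω : ℕ → Bool) (j : ℕ) (v : Fin n) => ω (j * n + v)) ⁻¹'
        Set.pi (range N : Set ℕ) fun _ => Kᶜ)ᶜ := by
    ext ω
    simp [hK, sample_eq_ofBits]
  have hfail : fairCoins.real ((fun (ω : ℕ → Bool) (j : ℕ) (v : Fin n) => ω (j * n + v)) ⁻¹'
      Set.pi (range N : Set ℕ) fun _ => Kᶜ) = (1 - (coins n).real K) ^ N := by
    rw [measureReal_def, ← map_apply hblocks hpim, fairCoins_map_blocks,
      infinitePi_pi _ fun _ _ => hKm.compl, prod_const, card_range, ENNReal.toReal_pow,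
      ← measureReal_def, probReal_compl_eq_one_sub hKm]
  have hp := card_le_coins W hW
  rw [← hK] at hp
  have hp1 : (coins n).real K ≤ 1 := measureReal_le_one
  have hpN : 1 ≤ (coins n).real K * N := by
    have h1 : (2 : ℝ) ^ n ≤ #W * N := by exact_mod_cast hcard
    calc (1 : ℝ) ≤ #W * N / 2 ^ n := by rwa [le_div_iff₀ (by positivity), one_mul]
      _ = #W / 2 ^ n * N := by ring
      _ ≤ _ := by gcongr
  have hle : (1 - (coins n).real K) ^ N ≤ 1 / 2 := by
    calc (1 - (coins n).real K) ^ N ≤ Real.exp (-(coins n).real K) ^ N := by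
          refine pow_le_pow_left₀ (by linarith) ?_ N
          linarith [Real.add_one_le_exp (-(coins n).real K)]
      _ = Real.exp (-((coins n).real K * N)) := by rw [← Real.exp_nat_mul]; ring_nf
      _ ≤ Real.exp (-1) := Real.exp_le_exp.2 (by linarith)
      _ ≤ 1 / 2 := by
          rw [Real.exp_neg, one_div]
          exact inv_anti₀ (by norm_num) (by linarith [Real.add_one_le_exp 1])
  rw [hset, ← ENNReal.ofReal_toReal (measure_ne_top _ _), ← measureReal_def,
    probReal_compl_eq_one_sub (hblocks hpim), hfail]
  exact ENNReal.ofReal_le_ofReal (by linarith)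

end Probability

end

section

open Finset

/-! ### Halves that split at most one colour -/

variable {n s r : ℕ} {A : ℕ → ℕ → Prop}

/-- `f` is a proper colouring of `{0, …, n - 1}` for the relation `A`. -/
def Proper (A : ℕ → ℕ → Prop) (n : ℕ) (f : ℕ → ℕ) : Prop :=
  ∀ u ∈ range n, ∀ v ∈ range n, A u v → f u ≠ f v

/-- Recolouring single vertices makes a colouring with at most `n` colours use all of them. -/
lemma exists_proper_image_eq (hr : r ≤ n) {f : ℕ → ℕ} (hf : Proper A n f)
    (hfr : (range n).image f ⊆ range r) :
    ∃ g, Proper A n g ∧ (range n).image g = range r := by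
  induction hd : r - #((range n).image f) using Nat.strong_induction_on generalizing f with
  | _ d ih =>
    by_cases heq : (range n).image f = range r
    · exact ⟨f, hf, heq⟩
    obtain ⟨c, hc, hc'⟩ := exists_of_ssubset (hfr.ssubset_of_ne heq)
    have hlt : #((range n).image f) < r := by
      simpa using card_lt_card (hfr.ssubset_of_ne heq)
    obtain ⟨u, hu, v, hv, huv, hfuv⟩ := exists_ne_map_eq_of_card_lt_of_maps_to
      (s := range n) (t := (range n).image f) (f := f) (by simpa using hlt.trans_le hr)
      (fun x hx => mem_image_of_mem f hx)
    have hne : ∀ x ∈ range n, f x ≠ c := fun x hx h => hc' (h ▸ mem_image_of_mem f hx)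
    have hsub : insert c ((range n).image f) ⊆ (range n).image (Function.update f u c) := by
      intro y hy
      rcases mem_insert.1 hy with rfl | hy
      · exact mem_image.2 ⟨u, hu, by simp⟩
      · obtain ⟨x, hx, rfl⟩ := mem_image.1 hy
        by_cases hxu : x = u
        · exact mem_image.2 ⟨v, hv, by simp [huv.symm, hxu, hfuv]⟩
        · exact mem_image.2 ⟨x, hx, by simp [hxu]⟩
    have hcard := card_le_card hsub
    rw [card_insert_of_notMem hc'] at hcard
    refine ih _ ?_ (f := Function.update f u c) ?_ ?_ rfl
    · omega
    · intro x hx y hy hxy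
      by_cases hxu : x = u <;> by_cases hyu : y = u
      · subst hxu; subst hyu; exact absurd rfl (hf _ hx _ hy hxy)
      · simpa [hxu, hyu] using (hne y hy).symm
      · simpa [hxu, hyu] using hne x hx
      · simpa [hxu, hyu] using hf x hx y hy hxy
    · intro y hy
      obtain ⟨x, hx, rfl⟩ := mem_image.1 hy
      by_cases hxu : x = u
      · simpa [hxu] using hc
      · simpa [hxu] using hfr (mem_image_of_mem f hx)

/-- Adding elements in the order of their colours, one can stop at any size; then at most one
colour is split. -/
lemma exists_threshold (R : Finset ℕ) (f : ℕ → ℕ) {q : ℕ} (hq : q ≤ #R) :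
    ∃ P ⊆ R, #P = q ∧ ∃ c, (∀ v ∈ R, f v < c → v ∈ P) ∧ ∀ v ∈ P, f v ≤ c := by
  classical
  have hex : ∃ c, q ≤ #{v ∈ R | f v ≤ c} :=
    ⟨R.sup f, by rwa [filter_true_of_mem fun v hv => le_sup hv]⟩
  have hmin : #{v ∈ R | f v < Nat.find hex} ≤ q := by
    rcases Nat.eq_zero_or_pos (Nat.find hex) with h | h
    · simp [h]
    · have := Nat.find_min hex (Nat.sub_lt h one_pos)
      refine (card_le_card ?_).trans (not_le.1 this).le
      intro v hv
      simp only [mem_filter] at hv ⊢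
      exact ⟨hv.1, by omega⟩
  obtain ⟨P, h1, h2, h3⟩ := exists_subsuperset_card_eq (s := {v ∈ R | f v < Nat.find hex})
    (t := {v ∈ R | f v ≤ Nat.find hex})
    (fun v hv => by simp only [mem_filter] at hv ⊢; exact ⟨hv.1, hv.2.le⟩) hmin
    (Nat.find_spec hex)
  exact ⟨P, fun v hv => (mem_filter.1 (h2 hv)).1, h3, Nat.find hex,
    fun v hv hlt => h1 (mem_filter.2 ⟨hv, hlt⟩), fun v hv => (mem_filter.1 (h2 hv)).2⟩

/-- Among `r` colour classes, some `r / 2` have a union of at most `n / 2` elements. -/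
lemma exists_light_colors (f : ℕ → ℕ) (n r : ℕ) :
    ∃ F ⊆ range r, #F = r / 2 ∧ #{v ∈ range n | f v ∈ F} ≤ n / 2 := by
  by_cases h : #{v ∈ range n | f v ∈ range (r / 2)} ≤ n / 2
  · exact ⟨range (r / 2), range_subset_range.2 (by omega), by simp, h⟩
  · refine ⟨Ico (r / 2) (2 * (r / 2)), fun x hx => ?_, by simp; omega, ?_⟩
    · have := (mem_Ico.1 hx).2
      exact mem_range.2 (by omega)
    · have hdisj : Disjoint {v ∈ range n | f v ∈ range (r / 2)}
          {v ∈ range n | f v ∈ Ico (r / 2) (2 * (r / 2))} := by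
        rw [disjoint_filter]
        intro v _ h1 h2
        have := mem_range.1 h1
        have := (mem_Ico.1 h2).1
        omega
      have h1 := card_le_card (union_subset (filter_subset (fun v => f v ∈ range (r / 2)) (range n))
        (filter_subset (fun v => f v ∈ Ico (r / 2) (2 * (r / 2))) (range n)))
      rw [card_union_of_disjoint hdisj, card_range] at h1
      omega

/-- A set that splits only one colour of a colouring: it and its complement together need at most
one colour more. -/
lemma chi_add_chi_le {f : ℕ → ℕ} (hf : Proper A n f) (hfr : (range n).image f ⊆ range r)
    {S : Finset ℕ} (hS : S ⊆ range n) (c : ℕ)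
    (hc : ∀ x ∈ S, ∀ y ∈ range n \ S, f x = f y → f x = c) :
    chi A n S + chi A n (range n \ S) ≤ r + 1 := by
  have key : ∀ T ⊆ range n, chi A n T ≤ #(T.image f) := fun T hT =>
    chi_le_of_covers_ne_zero (covers_ne_zero_of_coloring _ T f (fun v hv => mem_image_of_mem f hv)
      fun u hu v hv => hf u (hT hu) v (hT hv))
  have h1 : #(S.image f ∪ (range n \ S).image f) ≤ r := by
    rw [← image_union, union_sdiff_of_subset hS]
    simpa using card_le_card hfr
  have h2 : #(S.image f ∩ (range n \ S).image f) ≤ 1 := by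
    rw [card_le_one]
    have : ∀ a ∈ S.image f ∩ (range n \ S).image f, a = c := by
      intro a ha
      obtain ⟨h, h'⟩ := mem_inter.1 ha
      obtain ⟨x, hx, rfl⟩ := mem_image.1 h
      obtain ⟨y, hy, hxy⟩ := mem_image.1 h'
      exact hc x hx y hy hxy.symm
    intro a ha b hb
    rw [this a ha, this b hb]
  have h3 := card_union_add_card_inter (S.image f) ((range n \ S).image f)
  have h4 := key S hS
  have h5 := key (range n \ S) sdiff_subset
  omega

/-- Every choice among `r / 2` light colours extends to a set of `n / 2` vertices that splits at
most one further colour, and different choices give different sets. -/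
lemma exists_many_halves_of_proper {f : ℕ → ℕ} (hf : Proper A n f)
    (hfr : (range n).image f = range r) :
    ∃ W : Finset (Finset ℕ), 2 ^ (r / 2) ≤ #W ∧ ∀ S ∈ W, S ⊆ range n ∧ #S = n / 2 ∧
      chi A n S + chi A n (range n \ S) ≤ r + 1 := by
  obtain ⟨F, hF, hFcard, hlight⟩ := exists_light_colors f n r
  set R := {v ∈ range n | f v ∉ F} with hR
  have hRcard : #{v ∈ range n | f v ∈ F} + #R = n := by
    rw [hR, card_filter_add_card_filter_not, card_range]
  let U : Finset ℕ → Finset ℕ := fun T => {v ∈ range n | f v ∈ T}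
  have hUcard : ∀ T ⊆ F, #(U T) ≤ n / 2 := fun T hT =>
    (card_le_card (monotone_filter_right _ fun v _ h => hT h)).trans hlight
  have hP : ∀ T, n / 2 - #(U T) ≤ #R := fun T => by omega
  choose P hPR hPcard c hPc hPc' using fun T => exists_threshold R f (hP T)
  have hdisj : ∀ T ⊆ F, Disjoint (U T) (P T) := fun T hT => by
    rw [disjoint_left]
    intro v hv hv'
    exact (mem_filter.1 (hPR T hv')).2 (hT (mem_filter.1 hv).2)
  -- `U T ∪ P T` determines `T`, since all colours occur.
  have hrec : ∀ T ⊆ F, ∀ x, x ∈ T ↔ x ∈ F ∧ ∃ v ∈ U T ∪ P T, f v = x := by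
    intro T hT x
    constructor
    · intro hx
      obtain ⟨v, hv, rfl⟩ := mem_image.1 (hfr ▸ hF (hT hx))
      exact ⟨hT hx, v, mem_union_left _ (mem_filter.2 ⟨hv, hx⟩), rfl⟩
    · rintro ⟨hx, v, hv, rfl⟩
      rcases mem_union.1 hv with hv | hv
      · exact (mem_filter.1 hv).2
      · exact absurd hx (mem_filter.1 (hPR T hv)).2
  refine ⟨F.powerset.image fun T => U T ∪ P T, ?_, ?_⟩
  · rw [card_image_of_injOn, card_powerset, hFcard]
    intro T hT T' hT' h
    simp only [coe_powerset, Set.mem_preimage, Set.mem_powerset_iff, coe_subset] at hT hT'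
    ext x
    rw [hrec T hT, hrec T' hT']
    simp only at h
    rw [h]
  · intro S hS
    obtain ⟨T, hT, rfl⟩ := mem_image.1 hS
    rw [mem_powerset] at hT
    have hsub : U T ∪ P T ⊆ range n :=
      union_subset (filter_subset _ _) ((hPR T).trans (filter_subset _ _))
    refine ⟨hsub, ?_, chi_add_chi_le hf hfr.le hsub (c T) ?_⟩
    · have := hUcard T hT
      rw [card_union_of_disjoint (hdisj T hT), hPcard]
      omega
    · intro x hx y hy hxy
      obtain ⟨hyn, hy⟩ := mem_sdiff.1 hy
      rw [mem_union, not_or] at hy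
      rcases mem_union.1 hx with hx | hx
      · exact absurd (mem_filter.2 ⟨hyn, hxy ▸ (mem_filter.1 hx).2⟩) hy.1
      · have h1 := hPc' T x hx
        have hyR : y ∈ R := mem_filter.2 ⟨hyn, hxy ▸ (mem_filter.1 (hPR T hx)).2⟩
        have h2 : ¬ f y < c T := fun h => hy.2 (hPc T y hyR h)
        omega

lemma exists_many_halves (G : SimpleGraph (Fin n)) (hs : s ≤ n) (h : G.chromaticNumber < s) :
    ∃ W : Finset (Finset ℕ), 2 ^ ((s - 1) / 2) ≤ #W ∧ ∀ S ∈ W, S ⊆ range n ∧ #S = n / 2 ∧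
      chi (natAdj G) n S + chi (natAdj G) n (range n \ S) ≤ s := by
  have hs1 : 1 ≤ s := by
    rcases Nat.eq_zero_or_pos s with rfl | h'
    · simp at h
    · exact h'
  have hcol : G.Colorable (s - 1) := by
    rw [← SimpleGraph.chromaticNumber_le_iff_colorable]
    refine Order.le_of_lt_add_one ?_
    convert! h
    exact_mod_cast Nat.sub_add_cancel hs1
  obtain ⟨C⟩ := hcol
  let f : ℕ → ℕ := fun v => if h : v < n then (C ⟨v, h⟩ : Fin (s - 1)) else 0
  have hf : Proper (natAdj G) n f := by
    rintro _ _ _ _ ⟨i, j, hij, rfl, rfl⟩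
    simp only [f, i.2, j.2, dif_pos, ne_eq]
    exact fun h => C.valid hij (Fin.ext h)
  have hfr : (range n).image f ⊆ range (s - 1) := by
    intro y hy
    obtain ⟨v, hv, rfl⟩ := mem_image.1 hy
    have hv' := mem_range.1 hv
    simp only [f, hv', dif_pos, mem_range]
    exact (C ⟨v, hv'⟩).2
  obtain ⟨g, hg, hgr⟩ := exists_proper_image_eq (by omega) hf hfr
  obtain ⟨W, h1, h2⟩ := exists_many_halves_of_proper hg hgr
  exact ⟨W, h1, fun S hS => by simpa [Nat.sub_add_cancel hs1] using h2 S hS⟩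

/-- Conversely, colourings of a set and of its complement combine. -/
lemma chromaticNumber_le (G : SimpleGraph (Fin n)) {S : Finset ℕ} (hS : S ⊆ range n)
    (h : chi (natAdj G) n S + chi (natAdj G) n (range n \ S) ≤ s) : G.chromaticNumber ≤ s := by
  obtain ⟨g₁, h1, h2⟩ := exists_coloring_of_covers_ne_zero
    (covers_chi_ne_zero (natAdj_irrefl G) hS)
  obtain ⟨g₂, h3, h4⟩ := exists_coloring_of_covers_ne_zero
    (covers_chi_ne_zero (natAdj_irrefl G) (S := range n \ S) sdiff_subset)
  rw [SimpleGraph.chromaticNumber_le_iff_colorable]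
  have hmem : ∀ i : Fin n, (i : ℕ) ∉ S → (i : ℕ) ∈ range n \ S := fun i hi =>
    mem_sdiff.2 ⟨mem_range.2 i.2, hi⟩
  refine ⟨SimpleGraph.Coloring.mk (fun i => if hi : (i : ℕ) ∈ S
    then (⟨g₁ i, by have := h1 i hi; omega⟩ : Fin s)
    else ⟨chi (natAdj G) n S + g₂ i, by have := h3 i (hmem i hi); omega⟩) ?_⟩
  intro i j hij heq
  have hA : natAdj G i j := ⟨i, j, hij, rfl, rfl⟩
  by_cases hi : (i : ℕ) ∈ S <;> by_cases hj : (j : ℕ) ∈ S <;>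
    simp only [hi, hj, dif_pos, dif_neg, not_false_eq_true, Fin.mk.injEq] at heq
  · exact h2 _ hi _ hj hA heq
  · have := h1 i hi; omega
  · have := h1 j hj; omega
  · exact h4 _ (hmem i hi) _ (hmem j hj) hA (by omega)

end

section

open Finset

/-! ### The size of the family -/

/-- Chernoff's bound for the number of small subsets. -/
lemma card_small_subsets_le (n : ℕ) (r : ℝ) {x : ℝ} (hx : 0 < x) (hx1 : x ≤ 1) :
    (#{X ∈ (range n).powerset | (#X : ℝ) ≤ r} : ℝ) ≤ (1 + x) ^ n * x ^ (-r) := by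
  have h := Finset.sum_pow_mul_eq_add_pow x 1 (range n)
  simp only [one_pow, mul_one, card_range] at h
  rw [add_comm 1 x, ← h, Finset.sum_mul]
  calc (#{X ∈ (range n).powerset | (#X : ℝ) ≤ r} : ℝ)
      = ∑ X ∈ (range n).powerset with (#X : ℝ) ≤ r, (1 : ℝ) := by simp
    _ ≤ ∑ X ∈ (range n).powerset with (#X : ℝ) ≤ r, x ^ #X * x ^ (-r) := by
        refine sum_le_sum fun X hX => ?_
        rw [← Real.rpow_natCast, ← Real.rpow_add hx]
        exact Real.one_le_rpow_of_pos_of_le_one_of_nonpos hx hx1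
          (by linarith [(mem_filter.1 hX).2])
    _ ≤ _ := sum_le_sum_of_subset_of_nonneg (filter_subset _ _) fun X _ _ => by positivity

lemma card_below_half_le (n : ℕ) {ε : ℝ} (hε : 0 ≤ ε) :
    (#{X ∈ (range n).powerset | (#X : ℝ) ≤ n / 2 - ε * n} : ℝ) ≤
      2 ^ n * Real.exp (-(2 * ε ^ 2 * n)) := by
  refine (card_small_subsets_le n _ (Real.exp_pos (-(4 * ε)))
    (Real.exp_le_one_iff.2 (by linarith))).trans ?_
  have h1 : 1 + Real.exp (-(4 * ε)) = 2 * Real.cosh (2 * ε) * Real.exp (-(2 * ε)) := by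
    rw [Real.cosh_eq, mul_div_cancel₀ _ (by norm_num : (2 : ℝ) ≠ 0), add_mul, ← Real.exp_add,
      ← Real.exp_add]
    ring_nf
    simp [add_comm]
  have h2 : Real.exp (-(4 * ε)) ^ (-((n : ℝ) / 2 - ε * n)) =
      Real.exp (2 * ε) ^ n * Real.exp (-(4 * ε ^ 2 * n)) := by
    rw [← Real.exp_mul, ← Real.exp_nat_mul, ← Real.exp_add]
    ring_nf
  rw [h1, h2, mul_pow, mul_pow]
  have h3 : Real.exp (-(2 * ε)) ^ n * Real.exp (2 * ε) ^ n = 1 := by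
    rw [← mul_pow, ← Real.exp_add]; simp
  calc 2 ^ n * Real.cosh (2 * ε) ^ n * Real.exp (-(2 * ε)) ^ n *
        (Real.exp (2 * ε) ^ n * Real.exp (-(4 * ε ^ 2 * n)))
      = 2 ^ n * Real.cosh (2 * ε) ^ n * Real.exp (-(4 * ε ^ 2 * n)) *
        (Real.exp (-(2 * ε)) ^ n * Real.exp (2 * ε) ^ n) := by ring
    _ = 2 ^ n * (Real.cosh (2 * ε) ^ n * Real.exp (-(4 * ε ^ 2 * n))) := by rw [h3]; ring
    _ ≤ 2 ^ n * (Real.exp ((2 * ε) ^ 2 / 2) ^ n * Real.exp (-(4 * ε ^ 2 * n))) := by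
        gcongr
        exact Real.cosh_le_exp_half_sq _
    _ = _ := by
        rw [← Real.exp_nat_mul, ← Real.exp_add]
        ring_nf

/-- A member of the family is either small, or it is one of the `2 N` generators with a small
set removed. -/
lemma card_family_le (ω : ℕ → Bool) (n N : ℕ) (ε : ℝ) :
    #(family ω n N) ≤ #{X ∈ (range n).powerset | (#X : ℝ) ≤ n / 2 - ε * n} +
      2 * N * #{Z ∈ (range n).powerset | (#Z : ℝ) ≤ ε * n + 1} := by
  classical
  set 𝒵 := {Z ∈ (range n).powerset | (#Z : ℝ) ≤ ε * n + 1} with h𝒵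
  let g : Finset ℕ × ℕ → Finset ℕ := fun p => sample ω n p.2 \ p.1
  let g' : Finset ℕ × ℕ → Finset ℕ := fun p => (range n \ sample ω n p.2) \ p.1
  have hsub : family ω n N ⊆ {X ∈ (range n).powerset | (#X : ℝ) ≤ n / 2 - ε * n} ∪
      ((𝒵 ×ˢ range N).image g ∪ (𝒵 ×ˢ range N).image g') := by
    intro X hX
    obtain ⟨Y, hY, hXY⟩ := mem_family.1 hX
    have hYn := hY.subset
    by_cases hXs : (#X : ℝ) ≤ n / 2 - ε * n
    · exact mem_union_left _ (mem_filter.2 ⟨mem_powerset.2 (hXY.trans hYn), hXs⟩)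
    refine mem_union_right _ ?_
    obtain ⟨j, hj, hcard, hYj⟩ := hY
    have hYcard : (#Y : ℝ) ≤ n / 2 + 1 := by
      have : 2 * #Y ≤ n + 1 := by
        rcases hYj with rfl | rfl
        · omega
        · rw [card_sdiff_of_subset (sample_subset _ _ _), card_range]; omega
      have : (2 : ℝ) * #Y ≤ n + 1 := by exact_mod_cast this
      linarith
    have hZ : Y \ X ∈ 𝒵 := by
      refine mem_filter.2 ⟨mem_powerset.2 (sdiff_subset.trans hYn), ?_⟩
      rw [card_sdiff_of_subset hXY, Nat.cast_sub (card_le_card hXY)]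
      linarith
    have hXe : Y \ (Y \ X) = X := Finset.sdiff_sdiff_eq_self hXY
    have hp : (Y \ X, j) ∈ 𝒵 ×ˢ range N := mem_product.2 ⟨hZ, mem_range.2 hj⟩
    rcases hYj with h | h
    · exact mem_union_left _ (mem_image.2 ⟨_, hp, by simp only [g]; rw [← h, hXe]⟩)
    · exact mem_union_right _ (mem_image.2 ⟨_, hp, by simp only [g']; rw [← h, hXe]⟩)
  have h1 : #((𝒵 ×ˢ range N).image g) ≤ #𝒵 * N := by
    simpa using card_image_le (s := 𝒵 ×ˢ range N) (f := g)
  have h2 : #((𝒵 ×ˢ range N).image g') ≤ #𝒵 * N := by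
    simpa using card_image_le (s := 𝒵 ×ˢ range N) (f := g')
  have h3 := card_le_card hsub
  have h4 := card_union_le {X ∈ (range n).powerset | (#X : ℝ) ≤ n / 2 - ε * n}
    ((𝒵 ×ˢ range N).image g ∪ (𝒵 ×ˢ range N).image g')
  have h5 := card_union_le ((𝒵 ×ˢ range N).image g) ((𝒵 ×ˢ range N).image g')
  calc _ ≤ _ := h3.trans h4
    _ ≤ #{X ∈ (range n).powerset | (#X : ℝ) ≤ n / 2 - ε * n} + (#𝒵 * N + #𝒵 * N) := by omega
    _ = _ := by ring

lemma card_removed_le {n : ℕ} {x : ℝ} (hx : 0 < x) (hx1 : x ≤ 1) :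
    (#{Z ∈ (range n).powerset | (#Z : ℝ) ≤ (x / 16) ^ 2 * n + 1} : ℝ) ≤
      16 / x * Real.exp (x * n / 8) := by
  refine (card_small_subsets_le n _ (x := x / 16) (by positivity) (by linarith)).trans ?_
  have h1 : (1 + x / 16) ^ n ≤ Real.exp (x * n / 16) := by
    calc (1 + x / 16) ^ n ≤ Real.exp (x / 16) ^ n := by
          gcongr
          linarith [Real.add_one_le_exp (x / 16)]
      _ = _ := by rw [← Real.exp_nat_mul]; ring_nf
  have h2 : (x / 16) ^ (-((x / 16) ^ 2 * n + 1)) ≤ 16 / x * Real.exp (x * n / 16) := by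
    have hlog : Real.log (16 / x) ≤ 16 / x := (Real.log_le_sub_one_of_pos (by positivity)).trans
      (by linarith)
    have h16 : (x / 16) = (16 / x)⁻¹ := by rw [inv_div]
    rw [h16, Real.inv_rpow (by positivity), ← Real.rpow_neg (by positivity), neg_neg,
      Real.rpow_add (by positivity), Real.rpow_one, mul_comm, Real.rpow_def_of_pos (by positivity)]
    gcongr
    calc Real.log (16 / x) * ((16 / x)⁻¹ ^ 2 * n) ≤ 16 / x * ((16 / x)⁻¹ ^ 2 * n) := by gcongr
      _ = x * n / 16 := by field_simp
  calc _ ≤ Real.exp (x * n / 16) * (16 / x * Real.exp (x * n / 16)) := by gcongr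
    _ = 16 / x * (Real.exp (x * n / 16) * Real.exp (x * n / 16)) := by ring
    _ = _ := by rw [← Real.exp_add]; ring_nf

lemma samples_le {n s : ℕ} (hs : s ≤ n) :
    ((2 ^ (n - (s - 1) / 2) : ℕ) : ℝ) ≤ 2 * 2 ^ n * Real.exp (-(s / 4)) := by
  have h1 : ((s : ℝ) / 2 - 1) ≤ ((s - 1) / 2 : ℕ) := by
    have : s ≤ 2 * ((s - 1) / 2) + 2 := by omega
    have : (s : ℝ) ≤ 2 * ((s - 1) / 2 : ℕ) + 2 := by exact_mod_cast this
    linarith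
  have h2 : (s - 1) / 2 ≤ n := by omega
  have hlog := Real.log_two_gt_d9
  have e1 : (2 : ℝ) = Real.exp (Real.log 2) := (Real.exp_log two_pos).symm
  have e2 : (2 : ℝ) * 2 ^ n * Real.exp (-(s / 4)) =
      Real.exp (Real.log 2 + n * Real.log 2 + -(s / 4)) := by
    rw [Real.exp_add, Real.exp_add, Real.exp_nat_mul, ← e1]
  have e3 : ((2 ^ (n - (s - 1) / 2) : ℕ) : ℝ) =
      Real.exp (((n - (s - 1) / 2 : ℕ) : ℝ) * Real.log 2) := by
    rw [Real.exp_nat_mul, ← e1]; push_cast; rfl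
  rw [e2, e3, Real.exp_le_exp, Nat.cast_sub h2]
  have hs0 : (0 : ℝ) ≤ s := Nat.cast_nonneg s
  nlinarith

/-- The running time is governed by the number of samples and the size of the family. The threshold
between small and large members is `ε = (σ / 16) ^ 2`: the removed parts are then small enough to
leave a gain of `exp (-σ n / 8)`, while the small members gain `2 ε ^ 2 n = σ ^ 4 n / 32768`. -/
lemma samples_add_card_family_le (ω : ℕ → Bool) {n s N : ℕ} (hs : s ≤ n)
    (hN : 2 ^ (n - (s - 1) / 2) = N) :
    ((N + #(family ω n N) : ℕ) : ℝ) ≤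
      67 * (n + 1) * 2 ^ ((1 - 1 / 32768 * (min ((s : ℝ) / n) 1) ^ 4) * n) := by
  rcases Nat.eq_zero_or_pos s with rfl | hs0
  · have h1 : #(family ω n N) ≤ 2 ^ n := by
      calc #(family ω n N) ≤ #(range n).powerset := card_le_card fun X hX => by
              obtain ⟨Y, hY, hXY⟩ := mem_family.1 hX
              exact mem_powerset.2 (hXY.trans hY.subset)
        _ = 2 ^ n := by simp
    have h2 : N ≤ 2 ^ n := by rw [← hN]; simp
    have h3 : N + #(family ω n N) ≤ 2 * 2 ^ n := by omega
    have h4 : ((N + #(family ω n N) : ℕ) : ℝ) ≤ 2 * 2 ^ n := by exact_mod_cast h3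
    have h5 : (0 : ℝ) ≤ n := Nat.cast_nonneg n
    simp only [Nat.cast_zero, zero_div, zero_le_one, min_eq_left, ne_eq, OfNat.ofNat_ne_zero,
      not_false_eq_true, zero_pow, mul_zero, sub_zero, one_mul, Real.rpow_natCast]
    refine h4.trans ?_
    gcongr
    linarith
  have hn : (0 : ℝ) < n := by exact_mod_cast hs0.trans_le hs
  have hs1 : (1 : ℝ) ≤ s := by exact_mod_cast hs0
  have hsn : (s : ℝ) ≤ n := by exact_mod_cast hs
  set x : ℝ := s / n with hx
  have hx0 : 0 < x := by positivity
  have hx1 : x ≤ 1 := (div_le_one hn).2 hsn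
  have hxn : x * n = s := div_mul_cancel₀ _ hn.ne'
  rw [min_eq_left hx1]
  set E : ℝ := 2 ^ n * Real.exp (-(x ^ 4 / 32768 * n)) with hE
  have hx4 : x ^ 4 ≤ x := by
    calc x ^ 4 ≤ x ^ 1 := pow_le_pow_of_le_one hx0.le hx1 (by norm_num)
      _ = x := pow_one x
  have hexp : ∀ y : ℝ, y ≤ -(x * n / 8) → 2 ^ n * Real.exp y ≤ E := by
    intro y hy
    rw [hE]
    gcongr
    nlinarith
  have b1 : (#{X ∈ (range n).powerset | (#X : ℝ) ≤ n / 2 - (x / 16) ^ 2 * n} : ℝ) ≤ E := by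
    refine (card_below_half_le n (by positivity)).trans_eq ?_
    rw [hE]
    ring_nf
  have b2 := card_removed_le (n := n) hx0 hx1
  have b3 : (N : ℝ) ≤ 2 * 2 ^ n * Real.exp (-(x * n / 4)) := by
    rw [hxn, ← hN]; exact samples_le hs
  have b4 : (N : ℝ) ≤ 2 * E := by
    refine b3.trans ?_
    rw [mul_assoc]
    gcongr
    exact hexp _ (by nlinarith)
  have hinv : 16 / x ≤ 16 * n := by
    rw [div_le_iff₀ hx0, mul_assoc, mul_comm (n : ℝ), hxn]
    linarith
  have b5 : 2 * (N : ℝ) * #{Z ∈ (range n).powerset | (#Z : ℝ) ≤ (x / 16) ^ 2 * n + 1} ≤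
      64 * n * E := by
    calc _ ≤ 2 * (2 * 2 ^ n * Real.exp (-(x * n / 4))) * (16 * n * Real.exp (x * n / 8)) := by
          gcongr
          exact b2.trans (by gcongr)
      _ = 64 * n * (2 ^ n * (Real.exp (-(x * n / 4)) * Real.exp (x * n / 8))) := by ring
      _ = 64 * n * (2 ^ n * Real.exp (-(x * n / 8))) := by rw [← Real.exp_add]; ring_nf
      _ ≤ 64 * n * E := by gcongr; exact hexp _ le_rfl
  have b6 : (#(family ω n N) : ℝ) ≤
      #{X ∈ (range n).powerset | (#X : ℝ) ≤ n / 2 - (x / 16) ^ 2 * n} +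
      2 * N * #{Z ∈ (range n).powerset | (#Z : ℝ) ≤ (x / 16) ^ 2 * n + 1} := by
    exact_mod_cast card_family_le ω n N ((x / 16) ^ 2)
  have hE0 : 0 < E := by positivity
  have hEle : E ≤ 2 ^ ((1 - 1 / 32768 * x ^ 4) * n) := by
    rw [sub_mul, one_mul, sub_eq_add_neg, Real.rpow_add two_pos, Real.rpow_natCast, hE]
    gcongr
    rw [Real.rpow_def_of_pos two_pos, Real.exp_le_exp]
    have : Real.log 2 ≤ 1 := by linarith [Real.log_two_lt_d9]
    have h0 : 0 ≤ x ^ 4 * n := by positivity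
    nlinarith
  calc ((N + #(family ω n N) : ℕ) : ℝ) = N + #(family ω n N) := by push_cast; rfl
    _ ≤ 67 * (n + 1) * E := by nlinarith
    _ ≤ _ := by gcongr

end

/-! ### Time and correctness -/

section

open Finset

variable {n s : ℕ}

/-- A run that stays within its budget gives an answer in the sense of the statement. -/
lemma Runs.answers {ω : ℕ → Bool} {B k : ℕ} {P : Prog} {G : SimpleGraph (Fin n)}
    {Q : State → Prop} (h : Runs ω B P (initState n G s) k Q) :
    ∃ τ t, t ≤ k * (1000 * (B + 2) ^ 2) ∧ Q τ ∧ ∀ b, (b = true ↔ τ.reg 0 ≠ 0) →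
      Answers P G s ω b t := by
  obtain ⟨τ, t, h1, h2, h3⟩ := h
  exact ⟨τ, t, h2, h3, fun b hb => ⟨τ, h1, hb⟩⟩

/-- The case of more colours than vertices. -/
lemma answers_of_lt (G : SimpleGraph (Fin n)) (hs : n < s) (ω : ℕ → Bool) :
    ∃ t, Answers algorithm G s ω true t ∧ t ≤ 2000 * (inputSize n s + 3) ^ 2 := by
  set B := inputSize n s + 1 with hB
  have hnB : n < 2 ^ B := (Nat.lt_size_self n).trans_le
    (Nat.pow_le_pow_right (by norm_num) (by simp only [hB, inputSize]; omega))
  have hsB : s < 2 ^ B := (Nat.lt_size_self s).trans_le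
    (Nat.pow_le_pow_right (by norm_num) (by simp only [hB, inputSize]; omega))
  have hb := initState_bdd (B := B) G (by omega) hnB hsB
  have hrun : Runs ω B algorithm (initState n G s) 2 fun τ => τ.reg 0 = 1 := by
    refine .cond (k := 1) hb (by simp [Expr.wt]) le_rfl (fun _ => ?_) fun h => ?_
    · exact .assign hb (by simp [Expr.wt]) le_rfl (by simp [Expr.eval])
    · simp [Expr.eval, BinOp.eval, initState, hs] at h
  obtain ⟨τ, t, h1, h2, h3⟩ := hrun.answers
  refine ⟨t, h3 true (by simp [h2]), h1.trans_eq ?_⟩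
  rw [hB]; ring

/-- The time bound, the answer being described by the sampled family. -/
lemma answers_of_le (G : SimpleGraph (Fin n)) (hs : s ≤ n) (ω : ℕ → Bool) :
    ∃ (b : Bool) (t : ℕ), Answers algorithm G s ω b t ∧
      (b = true ↔ ∃ X ∈ family ω n (2 ^ (n - (s - 1) / 2)),
        range n \ X ∈ family ω n (2 ^ (n - (s - 1) / 2)) ∧
        chi (natAdj G) n X + chi (natAdj G) n (range n \ X) ≤ s) ∧
      t ≤ 10000000 * (inputSize n s + 1) ^ 3 *
        (2 ^ (n - (s - 1) / 2) + #(family ω n (2 ^ (n - (s - 1) / 2)))) := by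
  obtain ⟨τ, t, h1, h2, h3⟩ :=
    (runs_algorithm (ω := ω) (B := n * (n + 1) + 3) G hs (by omega) rfl).answers
  refine ⟨decide (τ.reg 0 ≠ 0), t, h3 _ (by simp), by simpa using h2, h1.trans ?_⟩
  set M := 2 ^ (n - (s - 1) / 2) + #(family ω n (2 ^ (n - (s - 1) / 2)))
  have hI : n ^ 2 ≤ inputSize n s := by simp only [inputSize]; omega
  set I := inputSize n s
  have hn : n ≤ n ^ 2 := Nat.le_self_pow (by norm_num) n
  have e1 : (n + 1) ^ 2 ≤ 2 * (I + 1) := by nlinarith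
  have e2 : n * (n + 1) + 3 + 2 ≤ 5 * (I + 1) := by nlinarith
  calc 200 * (n + 1) ^ 2 * M * (1000 * (n * (n + 1) + 3 + 2) ^ 2)
      ≤ 200 * (2 * (I + 1)) * M * (1000 * (5 * (I + 1)) ^ 2) := by gcongr
    _ = 10000000 * (I + 1) ^ 3 * M := by ring

end

end RandRAM

theorem theorem2 :
    ∃ (P : RandRAM.Prog) (c δ : ℝ) (p : Polynomial ℕ), 0 < c ∧ 0 < δ ∧
      ∀ (n : ℕ) (G : SimpleGraph (Fin n)) (s : ℕ),
        -- on every random tape, `P` halts within the time bound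
        (∀ ω : ℕ → Bool, ∃ (b : Bool) (t : ℕ), RandRAM.Answers P G s ω b t ∧
          (t : ℝ) ≤ ((p.eval (RandRAM.inputSize n s) : ℕ) : ℝ) *
            (2 : ℝ) ^ ((1 - c * (min ((s : ℝ) / n) 1) ^ 4) * n)) ∧
        -- if `χ(G) > s`, the answer is NO on every random tape
        ((s : ℕ∞) < G.chromaticNumber →
          ∀ ω : ℕ → Bool, ∃ t : ℕ, RandRAM.Answers P G s ω false t) ∧
        -- if `χ(G) < s`, the answer is YES with probability at least `δ`
        (G.chromaticNumber < (s : ℕ∞) →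
          ENNReal.ofReal δ ≤
            RandRAM.fairCoins {ω : ℕ → Bool | ∃ t : ℕ, RandRAM.Answers P G s ω true t}) := by
  refine ⟨RandRAM.algorithm, 1 / 32768, 1 / 2,
    Polynomial.C 670000000 * (Polynomial.X + 1) ^ 4, by norm_num, by norm_num, fun n G s => ?_⟩
  have hp : (Polynomial.C 670000000 * (Polynomial.X + 1) ^ 4 : Polynomial ℕ).eval
      (RandRAM.inputSize n s) = 670000000 * (RandRAM.inputSize n s + 1) ^ 4 := by simp
  rw [hp]
  set I := RandRAM.inputSize n s with hI
  rcases lt_or_ge n s with hs | hs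
  · refine ⟨fun ω => ?_, fun h => ?_, fun _ => ?_⟩
    · obtain ⟨t, h1, h2⟩ := RandRAM.answers_of_lt G hs ω
      refine ⟨true, t, h1, ?_⟩
      have hx0 : 0 ≤ min ((s : ℝ) / n) 1 := le_min (by positivity) zero_le_one
      have hx4 : (min ((s : ℝ) / n) 1) ^ 4 ≤ 1 := pow_le_one₀ hx0 (min_le_right _ _)
      have h3 : (1 : ℝ) ≤ 2 ^ ((1 - 1 / 32768 * (min ((s : ℝ) / n) 1) ^ 4) * n) :=
        Real.one_le_rpow one_le_two (mul_nonneg (by linarith) (Nat.cast_nonneg n))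
      have h4 : t ≤ 670000000 * (I + 1) ^ 4 := by
        have : 1 ≤ (I + 1) ^ 2 := Nat.one_le_pow _ _ (by omega)
        calc t ≤ 2000 * (I + 3) ^ 2 := h2
          _ ≤ 2000 * (3 * (I + 1)) ^ 2 := by gcongr; omega
          _ = 18000 * ((I + 1) ^ 2 * 1) := by ring
          _ ≤ 670000000 * ((I + 1) ^ 2 * (I + 1) ^ 2) := by gcongr; norm_num
          _ = _ := by ring
      have h5 : (t : ℝ) ≤ ((670000000 * (I + 1) ^ 4 : ℕ) : ℝ) := by exact_mod_cast h4
      exact h5.trans (le_mul_of_one_le_right (Nat.cast_nonneg _) h3)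
    · have h1 : G.chromaticNumber ≤ n := by
        rw [SimpleGraph.chromaticNumber_le_iff_colorable]
        simpa using G.colorable_of_fintype
      exact absurd (h.trans_le h1) (by exact_mod_cast hs.not_gt)
    · have : {ω : ℕ → Bool | ∃ t : ℕ, RandRAM.Answers RandRAM.algorithm G s ω true t} =
          Set.univ := Set.eq_univ_of_forall fun ω =>
        let ⟨t, h1, _⟩ := RandRAM.answers_of_lt G hs ω
        ⟨t, h1⟩
      have hP : MeasureTheory.IsProbabilityMeasure RandRAM.fairCoins := by
        unfold RandRAM.fairCoins; infer_instance
      rw [this, MeasureTheory.measure_univ]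
      exact ENNReal.ofReal_le_one.2 (by norm_num)
  · refine ⟨fun ω => ?_, fun h ω => ?_, fun h => ?_⟩
    · obtain ⟨b, t, h1, -, h2⟩ := RandRAM.answers_of_le G hs ω
      refine ⟨b, t, h1, ?_⟩
      have h3 := RandRAM.samples_add_card_family_le ω hs rfl
      have hn : (n : ℝ) ≤ I := by
        have : n ≤ I := by
          have := Nat.le_self_pow (two_ne_zero) n
          simp only [hI, RandRAM.inputSize]; omega
        exact_mod_cast this
      have h4 : (t : ℝ) ≤ 10000000 * (I + 1) ^ 3 * ((2 ^ (n - (s - 1) / 2) +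
          (RandRAM.family ω n (2 ^ (n - (s - 1) / 2))).card : ℕ) : ℝ) := by exact_mod_cast h2
      refine h4.trans ?_
      calc _ ≤ 10000000 * ((I : ℝ) + 1) ^ 3 * (67 * (I + 1) *
            2 ^ ((1 - 1 / 32768 * (min ((s : ℝ) / n) 1) ^ 4) * n)) := by
            gcongr
            exact h3.trans (by gcongr)
        _ = _ := by push_cast; ring
    · obtain ⟨b, t, h1, h2, -⟩ := RandRAM.answers_of_le G hs ω
      cases b with
      | false => exact ⟨t, h1⟩
      | true =>
        obtain ⟨X, hX, -, h3⟩ := h2.1 rfl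
        obtain ⟨Y, hY, hXY⟩ := RandRAM.mem_family.1 hX
        exact absurd h (RandRAM.chromaticNumber_le G (hXY.trans hY.subset) h3).not_gt
    · obtain ⟨W, hW, hW'⟩ := RandRAM.exists_many_halves G hs h
      refine (RandRAM.half_le_fairCoins (N := 2 ^ (n - (s - 1) / 2)) W (fun S hS => (hW' S hS).1)
        ?_).trans (MeasureTheory.measure_mono ?_)
      · calc 2 ^ n = 2 ^ ((s - 1) / 2) * 2 ^ (n - (s - 1) / 2) := by
              rw [← pow_add]; congr 1; omega
          _ ≤ _ := Nat.mul_le_mul_right _ hW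
      · rintro ω ⟨j, hj, hjW⟩
        obtain ⟨b, t, h1, h2, -⟩ := RandRAM.answers_of_le G hs ω
        obtain ⟨h3, h4, h5⟩ := hW' _ hjW
        have hb : b = true := h2.2 ⟨_, RandRAM.mem_family.2 ⟨_, ⟨j, hj, h4, .inl rfl⟩, subset_rfl⟩,
          RandRAM.mem_family.2 ⟨_, ⟨j, hj, h4, .inr rfl⟩, subset_rfl⟩, h5⟩
        exact ⟨t, hb ▸ h1⟩
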